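/- A graph $\Gamma=(V,E)$ consists of a finite set $V$ and a set $E$ of subsets of $V$ of size one (loops) or two; $\Gamma^-$ is $\Gamma$ with all loops deleted. The graph monoid $\mathbb{M}\Gamma$ is the monoid with generators $a_v,\bar a_v$ ($v\in V$) and relations $a_v\bar a_v=1$ for $v\in V$, and $xy=yx$ for all $x\in\{a_v,\bar a_v\}$, $y\in\{a_w,\bar a_w\}$ with $\{v,w\}\in E$ (here $v=w$ is allowed). For a monoid $M$ and a finite alphabet $X$, a valence automaton over $M$ has a finite set $Q$ of states, a finite set of edges in $Q\times X^*\times M\times Q$, an initial state $q_0$ and a set of final states. An edge $(q,x,n,q')$ leads from a configuration $(q,w,m)$ to $(q',wx,mn)$, and a word $w\in X^*$ is accepted if some configuration $(f,w,1)$ with $f$ final is reachable from $(q_0,\varepsilon,1)$. $\mathsf{VA}(M)$ is the class of languages accepted by valence automata over $M$. **Theorem.** Let $\Gamma$ be a graph such that $\Gamma^-$ contains the cycle $\mathsf{C4}$ or the path $\mathsf{P4}$ on four vertices as an induced subgraph. Then $\mathsf{VA}(\mathbb{M}\Gamma)$ is exactly the class of recursively enumerable languages (over finite alphabets), and this equality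 is effective: from a valence automaton over $\mathbb{M}\Gamma$ (with storage elements given as words over the generators) one can compute a program that semi-decides its language, and from an alphabet and a program that semi-decides a language over it one can compute a valence automaton over $\mathbb{M}\Gamma$ that accepts this language. In particular, the problem whether a given valence automaton over $\mathbb{M}\Gamma$ accepts the empty language is undecidable, even for every fixed finite input alphabet. -/

import Mathlib

universe u v w

/-- An undirected graph on the vertex set `V` without multiple edges, in which loops are allowed:
`Γ.Adj v w` says that `{v, w}` is an edge, and `Γ.Adj v v` that `v` is looped. -/
structure LoopGraph (V : Type u) where
  Adj : V → V → Prop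
  symm : ∀ v w, Adj v w → Adj w v

namespace LoopGraph

/-- The graph `Γ⁻` obtained from `Γ` by deleting all loops. -/
def deleteLoops {V : Type u} (Γ : LoopGraph V) : SimpleGraph V where
  Adj v w := v ≠ w ∧ Γ.Adj v w
  symm := ⟨fun v w h => ⟨h.1.symm, Γ.symm v w h.2⟩⟩
  loopless := ⟨fun _ h => h.1 rfl⟩

/-- The defining relations of the graph monoid. The letter `(v, true)` is the generator `a_v`, and
`(v, false)` is the generator `ā_v`. -/
inductive Rel {V : Type u} (Γ : LoopGraph V) :
    FreeMonoid (V × Bool) → FreeMonoid (V × Bool) → Prop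
  | cancel (v : V) : Rel Γ (FreeMonoid.of (v, true) * FreeMonoid.of (v, false)) 1
  | comm (v w : V) (s t : Bool) (h : Γ.Adj v w) :
      Rel Γ (FreeMonoid.of (v, s) * FreeMonoid.of (w, t))
        (FreeMonoid.of (w, t) * FreeMonoid.of (v, s))

/-- The graph monoid `𝕄Γ`: the quotient of the free monoid over `{a_v, ā_v | v ∈ V}` by the
smallest congruence containing the relations. -/
abbrev GraphMonoid {V : Type u} (Γ : LoopGraph V) : Type u := PresentedMonoid Γ.Rel

/-- The element of the graph monoid represented by a word over the generators. -/
def wordClass {V : Type u} (Γ : LoopGraph V) (g : List (V × Bool)) : Γ.GraphMonoid :=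
  PresentedMonoid.mk Γ.Rel (FreeMonoid.ofList g)

end LoopGraph

/-- A valence automaton over the monoid `M` with input alphabet `X`. -/
structure ValenceAutomaton (X : Type v) (M : Type w) where
  State : Type
  finite_state : Finite State
  edges : Set (State × List X × M × State)
  finite_edges : edges.Finite
  init : State
  final : Set State

namespace ValenceAutomaton

variable {X : Type v} {M : Type w} [Monoid M]

/-- One step between configurations (state, input read so far, storage content). -/
def Step (A : ValenceAutomaton X M) (c c' : A.State × List X × M) : Prop :=
  ∃ (x : List X) (n : M), (c.1, x, n, c'.1) ∈ A.edges ∧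
    c'.2.1 = c.2.1 ++ x ∧ c'.2.2 = c.2.2 * n

/-- The accepted language. -/
def language (A : ValenceAutomaton X M) : Language X :=
  {x | ∃ f ∈ A.final, Relation.ReflTransGen A.Step (A.init, [], 1) (f, x, 1)}

end ValenceAutomaton

/-- The languages over the alphabet `X` that are accepted by valence automata over `M`. -/
def VA (M : Type w) [Monoid M] (X : Type v) : Set (Language X) :=
  {L | ∃ A : ValenceAutomaton X M, A.language = L}

/-- A finite description of a valence automaton over a graph monoid. The states are the numbers
`0, …, lastState`, the initial state is `0`, letters of the input alphabet are given as numbers,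
and storage elements are given by words over the generators. -/
structure ValenceCode (V : Type u) where
  lastState : ℕ
  edges : List (ℕ × List ℕ × List (V × Bool) × ℕ)
  final : List ℕ

namespace ValenceCode

/-- A description is a triple of finite data. -/
def equivProd (V : Type u) :
    ValenceCode V ≃ ℕ × List (ℕ × List ℕ × List (V × Bool) × ℕ) × List ℕ where
  toFun c := (c.lastState, c.edges, c.final)
  invFun p := ⟨p.1, p.2.1, p.2.2⟩
  left_inv _ := rfl
  right_inv _ := rfl

instance {V : Type u} [Primcodable V] : Primcodable (ValenceCode V) :=
  Primcodable.ofEquiv _ (equivProd V)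

/-- The edges of the described automaton over the alphabet `Fin k`. Listed edges that mention a
state or a letter out of range are ignored. -/
def edgeSet {V : Type u} (Γ : LoopGraph V) (k : ℕ) (c : ValenceCode V) :
    Set (Fin (c.lastState + 1) × List (Fin k) × Γ.GraphMonoid × Fin (c.lastState + 1)) :=
  {e | ∃ g : List (V × Bool),
    (e.1.val, e.2.1.map Fin.val, g, e.2.2.2.val) ∈ c.edges ∧ e.2.2.1 = Γ.wordClass g}

theorem edgeSet_finite {V : Type u} (Γ : LoopGraph V) (k : ℕ) (c : ValenceCode V) :
    (c.edgeSet Γ k).Finite := by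
  have hfin : ((fun e : ℕ × List ℕ × List (V × Bool) × ℕ =>
      (e.1, e.2.1, Γ.wordClass e.2.2.1, e.2.2.2)) '' {e | e ∈ c.edges}).Finite :=
    (List.finite_toSet c.edges).image _
  refine Set.Finite.of_finite_image (f := fun e =>
    (e.1.val, e.2.1.map Fin.val, e.2.2.1, e.2.2.2.val)) (hfin.subset ?_) ?_
  · rintro _ ⟨⟨p, x, m, q⟩, ⟨g, hg, hm⟩, rfl⟩
    exact ⟨_, hg, by simpa using hm.symm⟩
  · rintro ⟨p, x, m, q⟩ - ⟨p', x', m', q'⟩ - h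
    simp only [Prod.mk.injEq] at h
    obtain ⟨h1, h2, h3, h4⟩ := h
    rw [Fin.ext h1, List.map_injective_iff.2 Fin.val_injective h2, h3, Fin.ext h4]

/-- The described valence automaton over `𝕄Γ` with input alphabet `Fin k`. -/
def toAutomaton {V : Type u} (Γ : LoopGraph V) (k : ℕ) (c : ValenceCode V) :
    ValenceAutomaton (Fin k) Γ.GraphMonoid where
  State := Fin (c.lastState + 1)
  finite_state := inferInstance
  edges := c.edgeSet Γ k
  finite_edges := c.edgeSet_finite Γ k
  init := 0
  final := {q | q.val ∈ c.final}

end ValenceCode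

/-- The recursively enumerable language over the alphabet `Fin k` represented by the program `c`:
the words on which `c` halts. -/
def reLanguage (k : ℕ) (c : Nat.Partrec.Code) : Language (Fin k) :=
  {x | (c.eval (Encodable.encode (x.map Fin.val))).Dom}

/-! One inclusion is a search. A word is accepted iff finitely many edges and applications of the
defining relations lead to a final state with empty storage word. Checking such a list is primitive
recursive, because for finite `V` the relations form a finite table. So acceptance is
semi-decidable, uniformly in the description.

For the converse, an induced C4 or P4 yields vertices `p, q, r, s` such that `p, q` and `s, r` are
non-adjacent while `p` commutes with `r` and `s`, and `q` with `s` (`LoopGraph.IsQuad`); whether `q`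
and `r` commute is irrelevant. Each non-adjacent pair serves as a tape on which the history `n₀, n₁,
…` of a machine with a single number is written, in blocks `a_p ^ n * a_q` and `a_s ^ n * a_r`. The
first tape is one block ahead: to replace `a * t + b` by `c * t + d`, the automaton guesses `t`,
appends the old value to the second tape and the new one to the first. At the end the last number is
copied to the second tape and both tapes are popped in parallel, which reaches `1` if they agree
(`LoopGraph.IsQuad.empties`).

Conversely, each tape has a homomorphism to a free group on two generators that turns barred
generators into inverses. Popping multiplies both images by the same element, so acceptance forces
the two products of blocks to coincide. By `blockProd_injective` the two histories are then equal,
and all guesses were right. No normal form in the graph monoid is needed.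

It remains to accept every recursively enumerable language with a single number. Relations testable
by counter machines are closed under conjunction, disjunction, existential quantification (guessing)
and reachability between pairs of numbers (`RegDef.tc`). Recursion and minimization are such
reachability statements, so all graphs of partial recursive functions are testable. Registers then
become exponents of primes. The machine is universal: its graph is fixed, and a program enters only
through the initial number. This makes the translation computable, and undecidability of emptiness
follows from the halting problem. -/

open Relation

/-! ### Finite graphs of actions -/

/-- One step in a finite graph whose edges are labelled by actions on a type `D` of data. -/
def GraphStep {Act D Q : Type*} (sem : Act → D → D → Prop) (E : List (Q × Act × Q))
    (c₁ c₂ : Q × D) : Prop :=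
  ∃ α, (c₁.1, α, c₂.1) ∈ E ∧ sem α c₁.2 c₂.2

/-- The actions of a counter machine: the registers are numbered by `ℕ`, and `read` reads a letter
of the input and adds its number to register `0`. -/
inductive RegAct
  | skip
  | inc (i : ℕ)
  | dec (i : ℕ)
  | zero (i : ℕ)
  | read

/-- Configurations of a counter machine: the input read so far and the register contents. -/
abbrev RegConf : Type := List ℕ × (ℕ → ℕ)

namespace RegConf

/-- Overwrite register `i`. -/
def set (d : RegConf) (i v : ℕ) : RegConf := (d.1, Function.update d.2 i v)

@[simp] theorem set_fst (d : RegConf) (i v : ℕ) : (d.set i v).1 = d.1 := rfl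

theorem set_snd (d : RegConf) (i v : ℕ) : (d.set i v).2 = Function.update d.2 i v := rfl

@[simp] theorem set_snd_self (d : RegConf) (i v : ℕ) : (d.set i v).2 i = v := by simp [set]

@[simp] theorem set_set (d : RegConf) (i v w : ℕ) : (d.set i v).set i w = d.set i w := by
  simp [set]

theorem set_snd_of_ne (d : RegConf) {i j : ℕ} (v : ℕ) (h : j ≠ i) : (d.set i v).2 j = d.2 j := by
  simp [set, h]

@[simp] theorem set_eq_self (d : RegConf) (i : ℕ) : d.set i (d.2 i) = d := by
  simp [set]

theorem set_eq_of_eq (d : RegConf) {i v : ℕ} (h : d.2 i = v) : d.set i v = d := by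
  subst h; simp

theorem set_comm (d : RegConf) {i j : ℕ} (v w : ℕ) (h : i ≠ j) :
    (d.set i v).set j w = (d.set j w).set i v := by
  simp [set, Function.update_comm h]

/-- All registers from `N` on are empty. -/
def Van (N : ℕ) (d : RegConf) : Prop := ∀ i, N ≤ i → d.2 i = 0

theorem Van.mono {N M : ℕ} {d : RegConf} (h : d.Van N) (hNM : N ≤ M) : d.Van M :=
  fun i hi => h i (hNM.trans hi)

theorem Van.set {N i : ℕ} {d : RegConf} (h : d.Van N) (hi : i < N) (v : ℕ) : (d.set i v).Van N := by
  intro j hj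
  rw [set_snd_of_ne _ _ (by omega)]
  exact h j hj

theorem Van.set_succ {N : ℕ} {d : RegConf} (h : d.Van N) (v : ℕ) : (d.set N v).Van (N + 1) :=
  (h.mono (Nat.le_succ N)).set (Nat.lt_succ_self N) v

end RegConf

/-- The meaning of the actions of a counter machine. -/
def RegAct.sem : RegAct → RegConf → RegConf → Prop
  | .skip, d, d' => d' = d
  | .inc i, d, d' => d' = d.set i (d.2 i + 1)
  | .dec i, d, d' => d.2 i ≠ 0 ∧ d' = d.set i (d.2 i - 1)
  | .zero i, d, d' => d.2 i = 0 ∧ d' = d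
  | .read, d, d' => ∃ a, d' = (d.1 ++ [a], Function.update d.2 0 (d.2 0 + a))

theorem GraphStep.of_skip {Q : Type*} {E : List (Q × RegAct × Q)} {q q' : Q}
    (h : (q, .skip, q') ∈ E) (d : RegConf) : GraphStep RegAct.sem E (q, d) (q', d) :=
  ⟨.skip, h, rfl⟩

/-- A relation between configurations is realizable if a finite graph of actions computes it. -/
def Realizable (R : RegConf → RegConf → Prop) : Prop :=
  ∃ (Q : Type) (_ : Encodable Q) (E : List (Q × RegAct × Q)) (s f : Q), ∀ d d',
    ReflTransGen (GraphStep RegAct.sem E) (s, d) (f, d') ↔ R d d'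

namespace Realizable

variable {R S : RegConf → RegConf → Prop}

theorem congr (hR : Realizable R) (h : ∀ d d', R d d' ↔ S d d') : Realizable S := by
  obtain ⟨Q, e, E, s, f, H⟩ := hR
  exact ⟨Q, e, E, s, f, fun d d' => (H d d').trans (h d d')⟩

theorem act (α : RegAct) : Realizable α.sem := by
  refine ⟨Bool, inferInstance, [(false, α, true)], false, true,
    fun d d' => ⟨fun h => ?_, fun h => ?_⟩⟩
  · have key : ∀ c, ReflTransGen (GraphStep RegAct.sem [(false, α, true)]) (false, d) c →
        (c.1 = false ∧ c.2 = d) ∨ (c.1 = true ∧ α.sem d c.2) := by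
      intro c hc
      induction hc with
      | refl => simp
      | tail _ hs ih =>
        obtain ⟨β, hβ, hsem⟩ := hs
        simp only [List.mem_singleton, Prod.mk.injEq] at hβ
        obtain ⟨h1, rfl, h2⟩ := hβ
        rcases ih with ⟨-, h⟩ | ⟨h, -⟩
        · exact .inr ⟨h2, h ▸ hsem⟩
        · simp [h1] at h
    simpa using key _ h
  · exact .single ⟨α, by simp, h⟩

theorem bot : Realizable fun _ _ => False := by
  refine ⟨Bool, inferInstance, [], false, true, fun d d' => ⟨fun h => ?_, False.elim⟩⟩
  rcases ReflTransGen.cases_tail h with h | ⟨c, -, β, hβ, -⟩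
  · simp at h
  · simp at hβ

theorem comp (hR : Realizable R) (hS : Realizable S) : Realizable (Relation.Comp R S) := by
  obtain ⟨Q₁, e₁, E₁, s₁, f₁, H₁⟩ := hR
  obtain ⟨Q₂, e₂, E₂, s₂, f₂, H₂⟩ := hS
  set E : List ((Q₁ ⊕ Q₂) × RegAct × (Q₁ ⊕ Q₂)) :=
    E₁.map (fun e => (Sum.inl e.1, e.2.1, Sum.inl e.2.2)) ++
      (E₂.map (fun e => (Sum.inr e.1, e.2.1, Sum.inr e.2.2)) ++
        [(Sum.inl f₁, .skip, Sum.inr s₂)]) with hE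
  refine ⟨Q₁ ⊕ Q₂, inferInstance, E, .inl s₁, .inr f₂, fun d d' => ⟨fun h => ?_, ?_⟩⟩
  · have key : ∀ c, ReflTransGen (GraphStep RegAct.sem E) (.inl s₁, d) c →
        (∀ q, c.1 = .inl q → ReflTransGen (GraphStep RegAct.sem E₁) (s₁, d) (q, c.2)) ∧
        (∀ q, c.1 = .inr q → ∃ e, R d e ∧
          ReflTransGen (GraphStep RegAct.sem E₂) (s₂, e) (q, c.2)) := by
      intro c hc
      induction hc with
      | refl => exact ⟨fun q hq => (by cases hq; exact .refl), fun q hq => (by cases hq)⟩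
      | @tail c c' _ hs ih =>
        obtain ⟨β, hβ, hsem⟩ := hs
        obtain ⟨q, c⟩ := c
        obtain ⟨q', c'⟩ := c'
        simp only [hE, List.mem_append, List.mem_map, List.mem_singleton, Prod.mk.injEq] at hβ
        rcases hβ with ⟨e, he, rfl, rfl, rfl⟩ | ⟨e, he, rfl, rfl, rfl⟩ | ⟨rfl, rfl, rfl⟩
        · refine ⟨fun q hq => ?_, fun q hq => (by cases hq)⟩
          cases hq
          exact (ih.1 _ rfl).tail ⟨_, he, hsem⟩
        · refine ⟨fun q hq => (by cases hq), fun q hq => ?_⟩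
          cases hq
          obtain ⟨a, ha, ha'⟩ := ih.2 _ rfl
          exact ⟨a, ha, ha'.tail ⟨_, he, hsem⟩⟩
        · refine ⟨fun q hq => (by cases hq), fun q hq => ?_⟩
          cases hq
          exact ⟨c, (H₁ _ _).1 (ih.1 _ rfl), by cases hsem; exact .refl⟩
    obtain ⟨e, he, he'⟩ := (key _ h).2 _ rfl
    exact ⟨e, he, (H₂ _ _).1 he'⟩
  · rintro ⟨e, h₁, h₂⟩
    have l₁ : ReflTransGen (GraphStep RegAct.sem E) (.inl s₁, d) (.inl f₁, e) :=
      ((H₁ _ _).2 h₁).lift (p := GraphStep RegAct.sem E) (fun c => (Sum.inl c.1, c.2))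
      (fun c c' ⟨β, hβ, hs⟩ => ⟨β, by simp [hE]; exact hβ, hs⟩)
    have l₂ : ReflTransGen (GraphStep RegAct.sem E) (.inr s₂, e) (.inr f₂, d') :=
      ((H₂ _ _).2 h₂).lift (p := GraphStep RegAct.sem E) (fun c => (Sum.inr c.1, c.2))
      (fun c c' ⟨β, hβ, hs⟩ => ⟨β, by simp [hE]; exact hβ, hs⟩)
    exact l₁.trans (.head (.of_skip (by simp [hE]) _) l₂)

/-- A new state `none`, both initial and final, separates complete passes; the given graph may
itself have loops through `s` or `f`. -/
theorem star (hR : Realizable R) : Realizable (ReflTransGen R) := by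
  obtain ⟨Q, e, E₁, s, f, H⟩ := hR
  set E : List (Option Q × RegAct × Option Q) :=
    E₁.map (fun e => (some e.1, e.2.1, some e.2.2)) ++
      [(none, .skip, some s), (some f, .skip, none)] with hE
  refine ⟨Option Q, inferInstance, E, none, none, fun d d' => ⟨fun h => ?_, fun h => ?_⟩⟩
  · have key : ∀ c, ReflTransGen (GraphStep RegAct.sem E) (none, d) c →
        (c.1 = none → ReflTransGen R d c.2) ∧
        (∀ q, c.1 = some q → ∃ e, ReflTransGen R d e ∧
          ReflTransGen (GraphStep RegAct.sem E₁) (s, e) (q, c.2)) := by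
      intro c hc
      induction hc with
      | refl => exact ⟨fun _ => .refl, fun q hq => (by cases hq)⟩
      | @tail c c' _ hs ih =>
        obtain ⟨β, hβ, hsem⟩ := hs
        obtain ⟨q, c⟩ := c
        obtain ⟨q', c'⟩ := c'
        simp only [hE, List.mem_append, List.mem_map, List.mem_cons, List.not_mem_nil, or_false,
          Prod.mk.injEq] at hβ
        rcases hβ with ⟨e, he, rfl, rfl, rfl⟩ | ⟨rfl, rfl, rfl⟩ | ⟨rfl, rfl, rfl⟩
        · refine ⟨fun hq => (by cases hq), fun q hq => ?_⟩
          cases hq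
          obtain ⟨a, ha, ha'⟩ := ih.2 _ rfl
          exact ⟨a, ha, ha'.tail ⟨_, he, hsem⟩⟩
        · refine ⟨fun hq => (by cases hq), fun q hq => ?_⟩
          cases hq
          exact ⟨c, ih.1 rfl, by cases hsem; exact .refl⟩
        · refine ⟨fun _ => ?_, fun q hq => (by cases hq)⟩
          obtain ⟨a, ha, ha'⟩ := ih.2 _ rfl
          cases hsem
          exact ha.tail ((H _ _).1 ha')
    exact (key _ h).1 rfl
  · induction h with
    | refl => exact .refl
    | @tail a b _ hab ih =>
      have l : ReflTransGen (GraphStep RegAct.sem E) (some s, a) (some f, b) :=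
        ((H _ _).2 hab).lift (p := GraphStep RegAct.sem E) (fun c => (some c.1, c.2))
        (fun c c' ⟨β, hβ, hs⟩ => ⟨β, by simp [hE]; exact hβ, hs⟩)
      exact ih.trans (.head (.of_skip (by simp [hE]) _) (l.tail (.of_skip (by simp [hE]) _)))

theorem or (hR : Realizable R) (hS : Realizable S) : Realizable fun d d' => R d d' ∨ S d d' := by
  obtain ⟨Q₁, e₁, E₁, s₁, f₁, H₁⟩ := hR
  obtain ⟨Q₂, e₂, E₂, s₂, f₂, H₂⟩ := hS
  set E : List (((Q₁ ⊕ Q₂) ⊕ Bool) × RegAct × ((Q₁ ⊕ Q₂) ⊕ Bool)) :=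
    E₁.map (fun e => (.inl (.inl e.1), e.2.1, .inl (.inl e.2.2))) ++
      (E₂.map (fun e => (.inl (.inr e.1), e.2.1, .inl (.inr e.2.2))) ++
        [(.inr false, .skip, .inl (.inl s₁)), (.inr false, .skip, .inl (.inr s₂)),
          (.inl (.inl f₁), .skip, .inr true), (.inl (.inr f₂), .skip, .inr true)]) with hE
  refine ⟨(Q₁ ⊕ Q₂) ⊕ Bool, inferInstance, E, .inr false, .inr true,
    fun d d' => ⟨fun h => ?_, fun h => ?_⟩⟩
  · have key : ∀ c, ReflTransGen (GraphStep RegAct.sem E) (.inr false, d) c →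
        (∀ q, c.1 = .inl (.inl q) → ReflTransGen (GraphStep RegAct.sem E₁) (s₁, d) (q, c.2)) ∧
        (∀ q, c.1 = .inl (.inr q) → ReflTransGen (GraphStep RegAct.sem E₂) (s₂, d) (q, c.2)) ∧
        (c.1 = .inr false → c.2 = d) ∧ (c.1 = .inr true → R d c.2 ∨ S d c.2) := by
      intro c hc
      induction hc with
      | refl => simp
      | @tail c c' _ hs ih =>
        obtain ⟨β, hβ, hsem⟩ := hs
        obtain ⟨q, c⟩ := c
        obtain ⟨q', c'⟩ := c'
        simp only [hE, List.mem_append, List.mem_map, List.mem_cons, List.not_mem_nil, or_false,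
          Prod.mk.injEq] at hβ
        obtain ⟨i1, i2, i3, i4⟩ := ih
        rcases hβ with ⟨e, he, rfl, rfl, rfl⟩ | ⟨e, he, rfl, rfl, rfl⟩ | ⟨rfl, rfl, rfl⟩ |
          ⟨rfl, rfl, rfl⟩ | ⟨rfl, rfl, rfl⟩ | ⟨rfl, rfl, rfl⟩
        · refine ⟨fun q hq => ?_, fun q hq => (by cases hq), fun hq => (by cases hq),
            fun hq => (by cases hq)⟩
          cases hq
          exact (i1 _ rfl).tail ⟨_, he, hsem⟩
        · refine ⟨fun q hq => (by cases hq), fun q hq => ?_, fun hq => (by cases hq),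
            fun hq => (by cases hq)⟩
          cases hq
          exact (i2 _ rfl).tail ⟨_, he, hsem⟩
        · refine ⟨fun q hq => ?_, fun q hq => (by cases hq), fun hq => (by cases hq),
            fun hq => (by cases hq)⟩
          cases hq
          cases hsem
          cases i3 rfl
          exact .refl
        · refine ⟨fun q hq => (by cases hq), fun q hq => ?_, fun hq => (by cases hq),
            fun hq => (by cases hq)⟩
          cases hq
          cases hsem
          cases i3 rfl
          exact .refl
        · refine ⟨fun q hq => (by cases hq), fun q hq => (by cases hq), fun hq => (by cases hq),
            fun _ => .inl ?_⟩
          cases hsem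
          exact (H₁ _ _).1 (i1 _ rfl)
        · refine ⟨fun q hq => (by cases hq), fun q hq => (by cases hq), fun hq => (by cases hq),
            fun _ => .inr ?_⟩
          cases hsem
          exact (H₂ _ _).1 (i2 _ rfl)
    exact (key _ h).2.2.2 rfl
  · rcases h with h | h
    · have l : ReflTransGen (GraphStep RegAct.sem E) (.inl (.inl s₁), d) (.inl (.inl f₁), d') :=
        ((H₁ _ _).2 h).lift (p := GraphStep RegAct.sem E)
        (fun c => (Sum.inl (Sum.inl c.1), c.2))
        (fun c c' ⟨β, hβ, hs⟩ => ⟨β, by simp [hE]; exact hβ, hs⟩)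
      exact (ReflTransGen.head (.of_skip (by simp [hE]) _) l).tail (.of_skip (by simp [hE]) _)
    · have l : ReflTransGen (GraphStep RegAct.sem E) (.inl (.inr s₂), d) (.inl (.inr f₂), d') :=
        ((H₂ _ _).2 h).lift (p := GraphStep RegAct.sem E)
        (fun c => (Sum.inl (Sum.inr c.1), c.2))
        (fun c c' ⟨β, hβ, hs⟩ => ⟨β, by simp [hE]; exact hβ, hs⟩)
      exact (ReflTransGen.head (.of_skip (by simp [hE]) _) l).tail (.of_skip (by simp [hE]) _)

/-- Emptying a register. -/
theorem clear (i : ℕ) : Realizable fun d d' => d' = d.set i 0 := by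
  refine ((act (.dec i)).star.comp (act (.zero i))).congr fun d d' => ⟨?_, ?_⟩
  · rintro ⟨e, he, h0, rfl⟩
    have : ∃ v, d' = d.set i v := by
      clear h0
      induction he with
      | refl => exact ⟨d.2 i, by simp⟩
      | tail _ hs ih =>
        obtain ⟨v, rfl⟩ := ih
        obtain ⟨-, rfl⟩ := hs
        exact ⟨_, RegConf.set_set _ _ _ _⟩
    obtain ⟨v, rfl⟩ := this
    simp only [RegConf.set_snd_self] at h0
    rw [h0]
  · rintro rfl
    refine ⟨d.set i 0, ?_, by simp [RegAct.sem]⟩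
    have : ∀ n (d : RegConf), d.2 i = n → ReflTransGen (RegAct.dec i).sem d (d.set i 0) := by
      intro n
      induction n with
      | zero => intro d hd; rw [RegConf.set_eq_of_eq _ hd]
      | succ n ih =>
        intro d hd
        refine .head (b := d.set i n) ⟨by omega, by simp [hd]⟩ ?_
        simpa using ih (d.set i n) (by simp)
    exact this _ d rfl

/-- Increasing a register by an arbitrary amount. -/
theorem raise (i : ℕ) : Realizable fun d d' => ∃ v, d' = d.set i (d.2 i + v) := by
  refine (act (.inc i)).star.congr fun d d' => ⟨fun h => ?_, ?_⟩
  · induction h with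
    | refl => exact ⟨0, by simp⟩
    | tail _ hs ih =>
      obtain ⟨v, rfl⟩ := ih
      cases hs
      exact ⟨v + 1, by simp [add_assoc]⟩
  · rintro ⟨v, rfl⟩
    induction v with
    | zero => simpa using .refl
    | succ v ih => exact ih.tail (by simp [RegAct.sem, add_assoc])

theorem transfer (i j : ℕ) (hij : i ≠ j) :
    Realizable fun d d' => ∃ v ≤ d.2 j, d' = (d.set i (d.2 i + v)).set j (d.2 j - v) := by
  refine ((act (.dec j)).comp (act (.inc i))).star.congr fun d d' => ⟨fun h => ?_, ?_⟩
  · induction h with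
    | refl =>
      exact ⟨0, by simp, by
        rw [Nat.add_zero, Nat.sub_zero, RegConf.set_eq_self, RegConf.set_eq_self]⟩
    | tail _ hs ih =>
      obtain ⟨v, hv, rfl⟩ := ih
      obtain ⟨e, ⟨h0, rfl⟩, rfl⟩ := hs
      simp only [RegConf.set_snd_self] at h0
      refine ⟨v + 1, by omega, ?_⟩
      simp only [RegConf.set_set, RegConf.set_snd_self, RegConf.set_snd_of_ne _ _ hij]
      rw [RegConf.set_comm _ _ _ hij.symm, RegConf.set_set, Nat.sub_sub, add_assoc]
  · rintro ⟨v, hv, rfl⟩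
    induction v with
    | zero =>
      rw [Nat.add_zero, Nat.sub_zero, RegConf.set_eq_self, RegConf.set_eq_self]
    | succ v ih =>
      refine (ih (by omega)).tail ⟨_, ⟨?_, rfl⟩, ?_⟩
      · simp only [RegConf.set_snd_self]; omega
      · simp only [RegAct.sem, RegConf.set_set, RegConf.set_snd_self, RegConf.set_snd_of_ne _ _ hij]
        rw [RegConf.set_comm _ _ _ hij.symm, RegConf.set_set, Nat.sub_sub, add_assoc]

/-- Moving the contents of register `j` into register `i`. -/
theorem move (i j : ℕ) (hij : i ≠ j) :
    Realizable fun d d' => d' = (d.set i (d.2 j)).set j 0 := by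
  refine ((clear i).comp ((transfer i j hij).comp (act (.zero j)))).congr fun d d' => ⟨?_, ?_⟩
  · rintro ⟨e, rfl, f, ⟨v, hv, rfl⟩, h0, rfl⟩
    simp only [RegConf.set_snd_self, RegConf.set_snd_of_ne _ _ hij.symm] at h0 hv ⊢
    obtain rfl : v = d.2 j := by omega
    simp
  · rintro rfl
    refine ⟨_, rfl, (d.set i (d.2 j)).set j 0, ⟨d.2 j, ?_, ?_⟩, ?_⟩
    · simp [RegConf.set_snd_of_ne _ _ hij.symm]
    · simp [RegConf.set_snd_of_ne _ _ hij.symm]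
    · simp [RegAct.sem]

end Realizable

/-! ### Relations definable by counter machines -/

namespace RegConf

theorem set_apply (d : RegConf) (i v k : ℕ) : (d.set i v).2 k = if k = i then v else d.2 k := by
  simp [set, Function.update_apply]

theorem ext_snd {d d' : RegConf} (h₁ : d.1 = d'.1) (h₂ : ∀ k, d.2 k = d'.2 k) : d = d' :=
  Prod.ext h₁ (funext h₂)

end RegConf

/-- `A` is realizable on the configurations whose registers from `N` on are empty. -/
def RealizableOn (N : ℕ) (A : RegConf → RegConf → Prop) : Prop :=
  ∃ R, Realizable R ∧ ∀ d, d.Van N → ∀ d', R d d' ↔ A d d'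

namespace RealizableOn

variable {N M : ℕ} {A B : RegConf → RegConf → Prop}

theorem congr (h : RealizableOn N A) (hAB : ∀ d, d.Van N → ∀ d', A d d' ↔ B d d') :
    RealizableOn N B := by
  obtain ⟨R, hR, H⟩ := h
  exact ⟨R, hR, fun d hd d' => (H d hd d').trans (hAB d hd d')⟩

theorem comp (hA : RealizableOn N A) (hB : RealizableOn M B)
    (h : ∀ d d', d.Van N → A d d' → d'.Van M) : RealizableOn N (Relation.Comp A B) := by
  obtain ⟨R, hR, H⟩ := hA
  obtain ⟨S, hS, H'⟩ := hB
  refine ⟨_, hR.comp hS, fun d hd d' => ⟨?_, ?_⟩⟩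
  · rintro ⟨e, he, he'⟩
    have := (H d hd e).1 he
    exact ⟨e, this, (H' e (h d e hd this) d').1 he'⟩
  · rintro ⟨e, he, he'⟩
    exact ⟨e, (H d hd e).2 he, (H' e (h d e hd he) d').2 he'⟩

/-- The auxiliary registers must be empty again after each pass, since the realization of `A` is
only known to be correct from such configurations. -/
theorem star (hA : RealizableOn N A) (h : ∀ d d', d.Van N → A d d' → d'.Van N) :
    RealizableOn N (ReflTransGen A) := by
  obtain ⟨R, hR, H⟩ := hA
  refine ⟨_, hR.star, fun d hd d' => ⟨fun hr => ?_, fun hr => ?_⟩⟩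
  · suffices ReflTransGen A d d' ∧ d'.Van N from this.1
    induction hr with
    | refl => exact ⟨.refl, hd⟩
    | tail _ hs ih =>
      have := (H _ ih.2 _).1 hs
      exact ⟨ih.1.tail this, h _ _ ih.2 this⟩
  · suffices ReflTransGen R d d' ∧ d'.Van N from this.1
    induction hr with
    | refl => exact ⟨.refl, hd⟩
    | tail _ hs ih => exact ⟨ih.1.tail ((H _ ih.2 _).2 hs), h _ _ ih.2 hs⟩

theorem or (hA : RealizableOn N A) (hB : RealizableOn N B) :
    RealizableOn N fun d d' => A d d' ∨ B d d' := by
  obtain ⟨R, hR, H⟩ := hA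
  obtain ⟨S, hS, K⟩ := hB
  exact ⟨_, hR.or hS, fun d hd e => or_congr (H d hd e) (K d hd e)⟩

/-- Filling the first empty register with an arbitrary number. -/
theorem guess (N : ℕ) : RealizableOn N fun d d' => ∃ v, d' = d.set N v :=
  ⟨_, .raise N, fun d hd d' => by simp [hd N le_rfl]⟩

end RealizableOn

theorem Realizable.on {A : RegConf → RegConf → Prop} (h : Realizable A) (N : ℕ) :
    RealizableOn N A :=
  ⟨A, h, fun _ _ _ => Iff.rfl⟩

/-- The property `φ` of the registers can be tested by a counter machine that uses the registers
from `N` on as auxiliary ones. -/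
def Testable (N : ℕ) (φ : (ℕ → ℕ) → Prop) : Prop :=
  RealizableOn N fun d d' => d' = d ∧ φ d.2

namespace Testable

variable {N : ℕ} {φ ψ : (ℕ → ℕ) → Prop}

theorem congr (h : Testable N φ) (H : ∀ σ, φ σ ↔ ψ σ) : Testable N ψ :=
  RealizableOn.congr h fun d _ d' => by simp [H]

theorem and (h : Testable N φ) (h' : Testable N ψ) : Testable N fun σ => φ σ ∧ ψ σ := by
  refine (RealizableOn.comp h h' ?_).congr fun d _ d' => ⟨?_, ?_⟩
  · rintro d d' hd ⟨rfl, -⟩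
    exact hd
  · rintro ⟨e, ⟨rfl, h1⟩, rfl, h2⟩
    exact ⟨rfl, h1, h2⟩
  · rintro ⟨rfl, h1, h2⟩
    exact ⟨_, ⟨rfl, h1⟩, rfl, h2⟩

theorem or (h : Testable N φ) (h' : Testable N ψ) : Testable N fun σ => φ σ ∨ ψ σ :=
  (RealizableOn.or h h').congr fun d _ d' => by tauto

theorem zero (N i : ℕ) : Testable N fun σ => σ i = 0 :=
  ((Realizable.act (.zero i)).on N).congr fun d _ d' => by simp [RegAct.sem, and_comm]

/-- Nondeterminism supplies the quantifier: guess the witness in register `N`, test, and erase it,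
so that the configuration is unchanged at the end. -/
theorem ex (h : Testable (N + 1) φ) : Testable N fun σ => ∃ v, φ (Function.update σ N v) := by
  refine (((RealizableOn.guess N).comp h ?_).comp ((Realizable.clear N).on (N + 1)) ?_).congr
    fun d hd d' => ⟨?_, ?_⟩
  · rintro d d' hd ⟨v, rfl⟩
    exact hd.set_succ v
  · rintro d d' hd ⟨e, ⟨v, rfl⟩, rfl, -⟩
    exact hd.set_succ v
  · rintro ⟨e, ⟨f, ⟨v, rfl⟩, rfl, h⟩, rfl⟩
    refine ⟨?_, v, h⟩
    rw [RegConf.set_set, RegConf.set_eq_of_eq _ (hd N le_rfl)]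
  · rintro ⟨rfl, v, h⟩
    refine ⟨_, ⟨_, ⟨v, rfl⟩, rfl, h⟩, ?_⟩
    beta_reduce
    rw [RegConf.set_set, RegConf.set_eq_of_eq _ (hd N le_rfl)]

/-- Both registers are counted down in step while register `N` counts the rounds. They can reach
zero together iff they were equal; afterwards `N` is used to restore them. -/
theorem eq (N i j : ℕ) (hi : i < N) (hj : j < N) : Testable N fun σ => σ i = σ j := by
  rcases eq_or_ne i j with rfl | hij
  · exact ((Realizable.act .skip).on N).congr fun d _ d' => by simp [RegAct.sem]
  have down := ((Realizable.act (.dec i)).comp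
    ((Realizable.act (.dec j)).comp (.act (.inc N)))).star
  have up := ((Realizable.act (.dec N)).comp
    ((Realizable.act (.inc i)).comp (.act (.inc j)))).star
  have tests := (Realizable.act (.zero i)).comp (.act (.zero j))
  refine ((down.comp (tests.comp (up.comp (.act (.zero N))))).on N).congr fun d hd d' => ⟨?_, ?_⟩
  · rintro ⟨_, he, e, ⟨_, ⟨h1, rfl⟩, h2, rfl⟩, _, hf, h3, rfl⟩
    -- Both loops conserve the sums of register `N` with `i` and with `j`, so the last zero test on
    -- `N` certifies complete restoration.
    have inv₁ : e.1 = d.1 ∧ (∀ k, k ≠ i → k ≠ j → k ≠ N → e.2 k = d.2 k) ∧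
        e.2 i + e.2 N = d.2 i ∧ e.2 j + e.2 N = d.2 j := by
      clear h1 h2 hf h3
      induction he with
      | refl => have := hd N le_rfl; simp [this]
      | tail _ hs ih =>
        obtain ⟨_, ⟨h1, rfl⟩, _, ⟨h2, rfl⟩, rfl⟩ := hs
        obtain ⟨i1, i2, i3, i4⟩ := ih
        simp only [RegConf.set_apply, RegConf.set_fst] at h1 h2 ⊢
        refine ⟨i1, fun k a b c => ?_, ?_, ?_⟩
        · simp [a, b, c, i2]
        · simp_all [hi.ne, hi.ne', hj.ne', hij.symm]; omega
        · simp_all [hi.ne', hj.ne, hj.ne', hij.symm]; omega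
    have inv₂ : d'.1 = e.1 ∧ (∀ k, k ≠ i → k ≠ j → k ≠ N → d'.2 k = e.2 k) ∧
        d'.2 i + d'.2 N = e.2 i + e.2 N ∧ d'.2 j + d'.2 N = e.2 j + e.2 N := by
      clear h1 h2 he h3
      induction hf with
      | refl => simp
      | tail _ hs ih =>
        obtain ⟨_, ⟨h1, rfl⟩, _, h2, rfl⟩ := hs
        cases h2
        obtain ⟨i1, i2, i3, i4⟩ := ih
        simp only [RegConf.set_apply, RegConf.set_fst] at h1 ⊢
        refine ⟨i1, fun k a b c => ?_, ?_, ?_⟩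
        · simp [a, b, c, i2]
        · simp_all [hi.ne, hi.ne', hj.ne', hij.symm]; omega
        · simp_all [hi.ne', hj.ne, hj.ne', hij.symm]; omega
    refine ⟨RegConf.ext_snd (inv₂.1.trans inv₁.1) fun k => ?_, by omega⟩
    have := hd N le_rfl
    by_cases a : k = i
    · subst a; omega
    by_cases b : k = j
    · subst b; omega
    by_cases c : k = N
    · subst c; omega
    rw [inv₂.2.1 k a b c, inv₁.2.1 k a b c]
  · rintro ⟨rfl, h⟩
    have hN := hd N le_rfl
    -- `e v` is the configuration after `v` rounds of counting down.
    have conf (v : ℕ) : ∃ e : RegConf, e = ((d'.set i (d'.2 i - v)).set j (d'.2 j - v)).set N v :=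
      ⟨_, rfl⟩
    choose e he using conf
    have e0 : e 0 = d' := by
      rw [he]
      refine RegConf.ext_snd rfl fun k => ?_
      simp only [RegConf.set_apply]
      split_ifs <;> simp_all
    have hst (v : ℕ) (k : ℕ) : (e v).2 k = if k = N then v else if k = j then d'.2 j - v else
        if k = i then d'.2 i - v else d'.2 k := by
      rw [he]; simp only [RegConf.set_apply]
    have he1 (v : ℕ) : (e v).1 = d'.1 := by rw [he]; rfl
    have l₁ : ∀ v, v ≤ d'.2 i → ReflTransGen (Relation.Comp (RegAct.dec i).sem
        (Relation.Comp (RegAct.dec j).sem (RegAct.inc N).sem)) d' (e v) := by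
      intro v
      induction v with
      | zero => intro _; rw [e0]
      | succ v ih =>
        intro hv
        refine (ih (by omega)).tail ⟨_, ⟨?_, rfl⟩, _, ⟨?_, rfl⟩, ?_⟩
        · simp [hst, hi.ne, hij]; omega
        · simp [hst, RegConf.set_apply, hj.ne, hij.symm]; omega
        · refine RegConf.ext_snd (by simp [he1]) fun k => ?_
          simp only [hst, RegConf.set_apply]
          grind
    have l₂ : ∀ v, v ≤ d'.2 i → ReflTransGen (Relation.Comp (RegAct.dec N).sem
        (Relation.Comp (RegAct.inc i).sem (RegAct.inc j).sem)) (e v) d' := by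
      intro v
      induction v with
      | zero => intro _; rw [e0]
      | succ v ih =>
        intro hv
        refine .head ⟨_, ⟨?_, rfl⟩, _, rfl, ?_⟩ (ih (by omega))
        · simp [hst]
        · refine RegConf.ext_snd (by simp [he1]) fun k => ?_
          simp only [hst, RegConf.set_apply]
          grind
    refine ⟨e (d'.2 i), l₁ _ le_rfl, e (d'.2 i), ⟨_, ⟨?_, rfl⟩, ?_, rfl⟩, d', l₂ _ le_rfl, hN, rfl⟩
    · simp [hst, hi.ne, hij]
    · simp [hst, hj.ne, h]

theorem succ (N i j : ℕ) (hi : i < N) (hj : j < N) : Testable N fun σ => σ j = σ i + 1 := by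
  rcases eq_or_ne i j with rfl | hij
  · exact (Realizable.bot.on N).congr fun d _ d' => by simp
  refine ((((Realizable.act (.dec j)).on N).comp (eq N i j hi hj) ?_).comp
    ((Realizable.act (.inc j)).on N) ?_).congr fun d hd d' => ⟨?_, ?_⟩
  · rintro d d' hd ⟨-, rfl⟩
    exact hd.set hj _
  · rintro d d' hd ⟨e, ⟨-, rfl⟩, rfl, -⟩
    exact hd.set hj _
  · rintro ⟨e, ⟨f, ⟨h0, rfl⟩, rfl, h⟩, rfl⟩
    simp only [RegConf.set_apply, if_neg hij, if_true] at h
    refine ⟨?_, by omega⟩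
    simp only [RegConf.set_set, RegConf.set_snd_self]
    exact RegConf.set_eq_of_eq _ (by omega)
  · rintro ⟨rfl, h⟩
    refine ⟨_, ⟨_, ⟨by omega, rfl⟩, rfl, ?_⟩, ?_⟩
    · simp only [RegConf.set_apply, if_neg hij, if_true]
      omega
    · simp only [RegAct.sem, RegConf.set_set, RegConf.set_snd_self]
      exact (RegConf.set_eq_of_eq _ (by omega)).symm

end Testable

/-- Put a number in front of a sequence. -/
def push (v : ℕ) (x : ℕ → ℕ) : ℕ → ℕ
  | 0 => v
  | n + 1 => x n

@[simp] theorem push_zero (v : ℕ) (x : ℕ → ℕ) : push v x 0 = v := rfl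

@[simp] theorem push_succ (v : ℕ) (x : ℕ → ℕ) (n : ℕ) : push v x (n + 1) = x n := rfl

theorem comp_push (σ : ℕ → ℕ) (i : ℕ) (ρ : ℕ → ℕ) : σ ∘ push i ρ = push (σ i) (σ ∘ ρ) := by
  funext n; cases n <;> rfl

theorem push_lt {N v : ℕ} {ρ : ℕ → ℕ} (hv : v < N) (hρ : ∀ i, ρ i < N) : ∀ i, push v ρ i < N
  | 0 => hv
  | n + 1 => hρ n

theorem update_comp_of_lt {N : ℕ} {ρ : ℕ → ℕ} (hρ : ∀ i, ρ i < N) (σ : ℕ → ℕ) (v : ℕ) :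
    Function.update σ N v ∘ ρ = σ ∘ ρ := by
  funext i
  simp [(hρ i).ne]

/-- A relation between numbers that can be tested by counter machines, whichever registers
hold the numbers. -/
def RegDef (R : (ℕ → ℕ) → Prop) : Prop :=
  ∀ (N : ℕ) (ρ : ℕ → ℕ), (∀ i, ρ i < N) → Testable N fun σ => R (σ ∘ ρ)

namespace RegDef

variable {R S A B : (ℕ → ℕ) → Prop}

theorem congr (h : RegDef R) (H : ∀ x, R x ↔ S x) : RegDef S :=
  fun N ρ hρ => (h N ρ hρ).congr fun _ => H _

theorem subst (h : RegDef R) (τ : ℕ → ℕ) : RegDef fun x => R (x ∘ τ) :=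
  fun N ρ hρ => (h N (ρ ∘ τ) fun i => hρ (τ i))

theorem and (h : RegDef R) (h' : RegDef S) : RegDef fun x => R x ∧ S x :=
  fun N ρ hρ => (h N ρ hρ).and (h' N ρ hρ)

theorem or (h : RegDef R) (h' : RegDef S) : RegDef fun x => R x ∨ S x :=
  fun N ρ hρ => (h N ρ hρ).or (h' N ρ hρ)

theorem ex (h : RegDef R) : RegDef fun x => ∃ v, R (push v x) := by
  intro N ρ hρ
  refine (h (N + 1) (push N ρ) (push_lt (by omega) fun i => (hρ i).trans (by omega))).ex.congr
    fun σ => exists_congr fun v => ?_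
  rw [comp_push, update_comp_of_lt hρ]
  simp

theorem zero (i : ℕ) : RegDef fun x => x i = 0 := fun N ρ _ => .zero N (ρ i)

theorem eq (i j : ℕ) : RegDef fun x => x i = x j := fun N ρ hρ => .eq N (ρ i) (ρ j) (hρ i) (hρ j)

theorem succ (i j : ℕ) : RegDef fun x => x j = x i + 1 :=
  fun N ρ hρ => .succ N (ρ i) (ρ j) (hρ i) (hρ j)

/-- Reachability under a definable step relation between pairs is definable. -/
theorem tc (hA : RegDef A) (hS : RegDef S) (hB : RegDef B) :
    RegDef fun x => ∃ u v : ℕ × ℕ, A (push u.1 (push u.2 x)) ∧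
      ReflTransGen (fun p q => S (push q.1 (push q.2 (push p.1 (push p.2 x))))) u v ∧
      B (push v.1 (push v.2 x)) := by
  intro N ρ hρ
  have hρ₁ : ∀ i, ρ i < N + 1 := fun i => (hρ i).trans (by omega)
  have hρ₂ : ∀ i, push (N + 1) (push N ρ) i < N + 2 :=
    push_lt (by omega) (push_lt (by omega) fun i => (hρ i).trans (by omega))
  have hρ₃ : ∀ i, push (N + 1) (push N ρ) i < N + 3 := fun i => (hρ₂ i).trans (by omega)
  have hρ₄ : ∀ i, push (N + 3) (push (N + 2) (push (N + 1) (push N ρ))) i < N + 4 :=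
    push_lt (by omega) (push_lt (by omega) fun i => (hρ₃ i).trans (by omega))
  -- Registers `N + 1` and `N` hold the current pair. Its successor is guessed in `N + 3` and `N +
  -- 2`, tested, and moved down.
  have step : RealizableOn (N + 2) fun d d' => ∃ q : ℕ × ℕ,
      S (push q.1 (push q.2 (push (d.2 (N + 1)) (push (d.2 N) (d.2 ∘ ρ))))) ∧
        d' = (d.set (N + 1) q.1).set N q.2 := by
    refine (((RealizableOn.guess (N + 2)).comp ((RealizableOn.guess (N + 3)).comp
      ((hS (N + 4) _ hρ₄).comp (((Realizable.move (N + 1) (N + 3) (by omega)).comp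
        (Realizable.move N (N + 2) (by omega))).on (N + 4)) ?_) ?_) ?_)).congr
        fun d hd d' => ⟨?_, ?_⟩
    · rintro d d' hd ⟨rfl, -⟩
      exact hd
    · rintro d d' hd ⟨v, rfl⟩
      exact hd.set_succ v
    · rintro d d' hd ⟨v, rfl⟩
      exact hd.set_succ v
    · rintro ⟨_, ⟨q₂, rfl⟩, _, ⟨q₁, rfl⟩, _, ⟨rfl, h⟩, _, rfl, rfl⟩
      refine ⟨(q₁, q₂), ?_, ?_⟩
      · rw [RegConf.set_snd, RegConf.set_snd, comp_push, comp_push, update_comp_of_lt hρ₃,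
          update_comp_of_lt hρ₂, comp_push, comp_push] at h
        simpa using h
      · have h2 := hd (N + 2) le_rfl
        have h3 := hd (N + 3) (by omega)
        refine RegConf.ext_snd rfl fun k => ?_
        simp only [RegConf.set_apply]
        split_ifs <;> simp_all
    · rintro ⟨q, h, rfl⟩
      refine ⟨_, ⟨q.2, rfl⟩, _, ⟨q.1, rfl⟩, _, ⟨rfl, ?_⟩, _, rfl, ?_⟩
      · beta_reduce
        rw [RegConf.set_snd, RegConf.set_snd, comp_push, comp_push, update_comp_of_lt hρ₃,
          update_comp_of_lt hρ₂, comp_push, comp_push]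
        simpa using h
      · have h2 := hd (N + 2) le_rfl
        have h3 := hd (N + 3) (by omega)
        refine RegConf.ext_snd rfl fun k => ?_
        simp only [RegConf.set_apply]
        split_ifs <;> simp_all
  have hstep : ∀ (d d' : RegConf), d.Van (N + 2) → (∃ q : ℕ × ℕ,
      S (push q.1 (push q.2 (push (d.2 (N + 1)) (push (d.2 N) (d.2 ∘ ρ))))) ∧
        d' = (d.set (N + 1) q.1).set N q.2) → d'.Van (N + 2) := by
    rintro d d' hd ⟨q, -, rfl⟩
    exact (hd.set (by omega) _).set (by omega) _
  have loop : RealizableOn (N + 2) fun d d' => ∃ q : ℕ × ℕ,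
      ReflTransGen (fun p q : ℕ × ℕ => S (push q.1 (push q.2 (push p.1 (push p.2 (d.2 ∘ ρ))))))
        (d.2 (N + 1), d.2 N) q ∧ d' = (d.set (N + 1) q.1).set N q.2 := by
    refine (step.star hstep).congr fun d hd d' => ⟨fun h => ?_, ?_⟩
    · induction h with
      | refl => exact ⟨_, .refl, by simp [RegConf.set_eq_of_eq]⟩
      | tail _ hs ih =>
        obtain ⟨q, hq, rfl⟩ := ih
        obtain ⟨q', hq', rfl⟩ := hs
        refine ⟨q', hq.tail ?_, ?_⟩
        · rw [RegConf.set_snd, RegConf.set_snd, update_comp_of_lt hρ, update_comp_of_lt hρ₁] at hq'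
          simpa using hq'
        · refine RegConf.ext_snd rfl fun k => ?_
          simp only [RegConf.set_apply]
          split_ifs <;> rfl
    · rintro ⟨q, hq, rfl⟩
      induction hq with
      | refl => rw [RegConf.set_eq_self, RegConf.set_eq_self]
      | @tail q q' _ hs ih =>
        refine ih.tail ⟨q', ?_, ?_⟩
        · rw [RegConf.set_snd, RegConf.set_snd, update_comp_of_lt hρ, update_comp_of_lt hρ₁]
          simpa using hs
        · refine RegConf.ext_snd rfl fun k => ?_
          simp only [RegConf.set_apply]
          split_ifs <;> rfl
  refine (((RealizableOn.guess N).comp ((RealizableOn.guess (N + 1)).comp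
    ((hA (N + 2) _ hρ₂).comp (loop.comp ((hB (N + 2) _ hρ₂).comp
      (((Realizable.clear (N + 1)).comp (.clear N)).on (N + 2)) ?_) ?_) ?_) ?_) ?_)).congr
      fun d hd d' => ⟨?_, ?_⟩
  · rintro d d' hd ⟨rfl, -⟩
    exact hd
  · rintro d d' hd ⟨q, -, rfl⟩
    exact (hd.set (by omega) _).set (by omega) _
  · rintro d d' hd ⟨rfl, -⟩
    exact hd
  · rintro d d' hd ⟨v, rfl⟩
    exact hd.set_succ v
  · rintro d d' hd ⟨v, rfl⟩
    exact hd.set_succ v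
  · rintro ⟨_, ⟨u₂, rfl⟩, _, ⟨u₁, rfl⟩, _, ⟨rfl, ha⟩, _, ⟨q, hq, rfl⟩, _, ⟨rfl, hb⟩, _, rfl, rfl⟩
    simp only [RegConf.set_snd, comp_push, update_comp_of_lt hρ, update_comp_of_lt hρ₁] at ha hb hq
    refine ⟨?_, (u₁, u₂), q, by simpa using ha, by simpa using hq, by simpa using hb⟩
    have h0 := hd N le_rfl
    have h1 := hd (N + 1) (by omega)
    refine RegConf.ext_snd rfl fun k => ?_
    simp only [RegConf.set_apply]
    split_ifs <;> simp_all
  · rintro ⟨rfl, u, q, ha, hq, hb⟩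
    refine ⟨_, ⟨u.2, rfl⟩, _, ⟨u.1, rfl⟩, _, ⟨rfl, ?_⟩, _, ⟨q, ?_, rfl⟩, _, ⟨rfl, ?_⟩, _, rfl, ?_⟩
    · simp only [RegConf.set_snd, comp_push, update_comp_of_lt hρ, update_comp_of_lt hρ₁]
      simpa using ha
    · simp only [RegConf.set_snd, update_comp_of_lt hρ, update_comp_of_lt hρ₁]
      simpa using hq
    · simp only [RegConf.set_snd, comp_push, update_comp_of_lt hρ, update_comp_of_lt hρ₁]
      simpa using hb
    · have h0 := hd N le_rfl
      have h1 := hd (N + 1) (by omega)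
      refine RegConf.ext_snd rfl fun k => ?_
      simp only [RegConf.set_apply]
      split_ifs <;> simp_all

end RegDef

/-! ### Partial recursive functions are definable -/

namespace RegDef

/-- Reachability from `(x i, 0)` to `(x k, x j)` when both components grow by one. In a step
relation for `tc`, indices `0, 1` denote the new pair, `2, 3` the old one, and parameters start at
`4`; in the two end conditions they start at `2`. -/
theorem add (i j k : ℕ) : RegDef fun x => x i + x j = x k := by
  refine (tc ((eq 0 (i + 2)).and (zero 1)) ((succ 2 0).and (succ 3 1))
    ((eq 0 (k + 2)).and (eq 1 (j + 2)))).congr fun x => ⟨?_, fun h => ?_⟩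
  · rintro ⟨u, v, ⟨h1, h2⟩, h, h3, h4⟩
    simp only [push_zero, push_succ] at h1 h2 h3 h4
    have : v.1 + u.2 = v.2 + u.1 := by
      clear h3 h4
      induction h with
      | refl => exact Nat.add_comm _ _
      | tail _ hs ih =>
        simp only [push_zero, push_succ] at hs
        omega
    omega
  · refine ⟨(x i, 0), (x k, x j), ⟨rfl, rfl⟩, ?_, rfl, rfl⟩
    rw [← h]
    generalize x j = m
    induction m with
    | zero => exact .refl
    | succ m ih => exact ih.tail ⟨rfl, rfl⟩

theorem mul (i j k : ℕ) : RegDef fun x => x i * x j = x k := by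
  refine (tc ((zero 0).and (zero 1)) ((succ 2 0).and (add 3 (i + 4) 1))
    ((eq 0 (j + 2)).and (eq 1 (k + 2)))).congr fun x => ⟨?_, fun h => ?_⟩
  · rintro ⟨u, v, ⟨h1, h2⟩, h, h3, h4⟩
    simp only [push_zero, push_succ] at h1 h2 h3 h4
    have : x i * v.1 = v.2 := by
      clear h3 h4
      induction h with
      | refl => simp [h1, h2]
      | tail _ hs ih =>
        simp only [push_zero, push_succ] at hs
        rw [hs.1, ← hs.2, mul_add, ih, mul_one]
    rw [← h3, ← h4, this]
  · refine ⟨(0, 0), (x j, x k), ⟨rfl, rfl⟩, ?_, rfl, rfl⟩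
    rw [← h]
    generalize x j = m
    induction m with
    | zero => exact .refl
    | succ m ih => exact ih.tail ⟨rfl, rfl⟩

theorem le (i j : ℕ) : RegDef fun x => x i ≤ x j :=
  (add (i + 1) 0 (j + 1)).ex.congr fun x => by
    simp only [push_zero, push_succ]
    exact ⟨fun ⟨v, h⟩ => by omega, fun h => ⟨x j - x i, by omega⟩⟩

theorem lt (i j : ℕ) : RegDef fun x => x i < x j :=
  ((succ (i + 1) 0).and (le 0 (j + 1))).ex.congr fun x => by
    simp only [push_zero, push_succ]
    exact ⟨fun ⟨v, h⟩ => by omega, fun h => ⟨x i + 1, by omega⟩⟩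

theorem pair (i j k : ℕ) : RegDef fun x => x k = Nat.pair (x i) (x j) := by
  have h₁ := ((lt i j).and ((mul (j + 1) (j + 1) 0).and (add 0 (i + 1) (k + 1))).ex)
  have h₂ := ((le j i).and ((mul (i + 2) (i + 2) 0).and
    ((add 0 (i + 2) 1).and (add 1 (j + 2) (k + 2)))).ex.ex)
  refine (h₁.or h₂).congr fun x => ?_
  simp only [push_zero, push_succ, Nat.pair]
  split_ifs with h
  · constructor
    · rintro (⟨-, v, rfl, h⟩ | ⟨h', -⟩) <;> omega
    · rintro h'
      exact .inl ⟨h, _, rfl, h'.symm⟩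
  · constructor
    · rintro (⟨h', -⟩ | ⟨-, v, w, rfl, rfl, h⟩)
      · omega
      · exact h.symm
    · rintro h'
      exact .inr ⟨by omega, _, _, rfl, rfl, h'.symm⟩

end RegDef

/-- The graph of a partial function is definable. -/
def GraphDef (f : ℕ →. ℕ) : Prop := RegDef fun x => x 1 ∈ f (x 0)

namespace GraphDef

variable {f g : ℕ →. ℕ}

theorem at_index (h : GraphDef f) (i j : ℕ) : RegDef fun x => x j ∈ f (x i) :=
  h.subst (push i fun _ => j)

theorem at_pair (h : GraphDef f) (i i' j : ℕ) : RegDef fun x => x j ∈ f (Nat.pair (x i) (x i')) :=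
  ((RegDef.pair (i + 1) (i' + 1) 0).and (h.at_index 0 (j + 1))).ex.congr fun x => by simp

/-- A recursion is a path through the pairs (argument, value), from `(0, b)` with `b ∈ f a`. Working
with reachability avoids coding computation sequences as numbers. -/
theorem prec (hf : GraphDef f) (hg : GraphDef g) : GraphDef (Nat.unpaired fun a n =>
    n.rec (f a) fun y IH => do let i ← IH; g (Nat.pair a (Nat.pair y i))) := by
  have step : RegDef fun x => x 0 = x 2 + 1 ∧
      ∃ w, w = Nat.pair (x 2) (x 3) ∧ x 1 ∈ g (Nat.pair (x 4) w) :=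
    (RegDef.succ 2 0).and ((RegDef.pair 3 4 0).and (hg.at_pair 5 0 2)).ex
  refine ((RegDef.pair 0 1 2).and (RegDef.tc ((RegDef.zero 0).and (hf.at_index 2 1)) step
    ((RegDef.eq 0 3).and (RegDef.eq 1 5)))).ex.ex.congr fun x => ?_
  simp only [push_zero, push_succ, Nat.unpaired, exists_eq_left]
  constructor
  · rintro ⟨n, a, hx, u, v, ⟨h1, h2⟩, h, h3, h4⟩
    rw [hx, Nat.unpair_pair]
    simp only [← h3]
    rw [show x 1 = v.2 from h4.symm]
    clear h3 h4
    induction h with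
    | refl => rw [h1]; exact h2
    | tail _ hs ih =>
      rw [hs.1]
      exact Part.mem_bind_iff.2 ⟨_, ih, hs.2⟩
  · intro h
    refine ⟨(x 0).unpair.2, (x 0).unpair.1, (Nat.pair_unpair _).symm, ?_⟩
    generalize (x 0).unpair.1 = a at *
    generalize (x 0).unpair.2 = n at *
    suffices ∀ y, y ∈ Nat.rec (motive := fun _ => Part ℕ) (f a)
        (fun y IH => do let i ← IH; g (Nat.pair a (Nat.pair y i))) n →
        ∃ b ∈ f a, ReflTransGen (fun p q : ℕ × ℕ => q.1 = p.1 + 1 ∧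
          q.2 ∈ g (Nat.pair a (Nat.pair p.1 p.2))) (0, b) (n, y) by
      obtain ⟨b, hb, hr⟩ := this _ h
      exact ⟨(0, b), (n, x 1), ⟨rfl, hb⟩, hr, rfl, rfl⟩
    clear h
    induction n with
    | zero => exact fun y hy => ⟨y, hy, .refl⟩
    | succ n ih =>
      intro y hy
      obtain ⟨i, hi, hy⟩ := Part.mem_bind_iff.1 hy
      obtain ⟨b, hb, hr⟩ := ih i hi
      exact ⟨b, hb, hr.tail ⟨rfl, hy⟩⟩

/-- The first component of the pair is the search position, the second is arbitrary. The position
moves on only past a defined nonzero value, so reaching `n` from `0` says that all earlier values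
are defined and nonzero. -/
theorem rfind (hf : GraphDef f) :
    GraphDef fun a => Nat.rfind fun n => (fun m => m = 0) <$> f (Nat.pair a n) := by
  have step : RegDef fun x => x 0 = x 2 + 1 ∧
      ∃ m w, w = m + 1 ∧ w ∈ f (Nat.pair (x 4) (x 2)) :=
    (RegDef.succ 2 0).and ((RegDef.succ 1 0).and (hf.at_pair 6 4 0)).ex.ex
  refine (RegDef.tc (RegDef.zero 0) step ((RegDef.eq 0 3).and
    ((RegDef.zero 0).and (hf.at_pair 3 1 0)).ex)).congr fun x => ?_
  simp only [push_zero, push_succ, exists_eq_left]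
  refine Iff.trans ?_ Nat.mem_rfind.symm
  constructor
  · rintro ⟨u, v, h1, h, h3, h4⟩
    change v.1 = x 1 at h3
    change 0 ∈ f (Nat.pair (x 0) v.1) at h4
    rw [← h3]
    refine ⟨by simpa using h4, ?_⟩
    clear h3 h4
    induction h with
    | refl => intro m hm; omega
    | tail _ hs ih =>
      intro m hm
      rcases (Nat.lt_succ_iff_lt_or_eq.1 (hs.1 ▸ hm : m < _ + 1)) with hm | rfl
      · exact ih hm
      · obtain ⟨w, hw⟩ := hs.2
        exact (Part.mem_map_iff _).2 ⟨_, hw, by simp⟩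
  · rintro ⟨h0, h⟩
    refine ⟨(0, 0), (x 1, 0), rfl, ?_, rfl, by simpa using h0⟩
    clear h0
    generalize x 1 = n at h
    induction n with
    | zero => exact .refl
    | succ n ih =>
      refine (ih fun hm => h (by omega)).tail ⟨rfl, ?_⟩
      obtain ⟨w, hw, hw'⟩ := (Part.mem_map_iff _).1 (h (Nat.lt_succ_self n))
      refine ⟨w - 1, ?_⟩
      have : w ≠ 0 := by simpa using hw'
      rwa [Nat.sub_add_cancel (by omega)]

theorem of_partrec (hf : Nat.Partrec f) : GraphDef f := by
  induction hf with
  | zero => exact (RegDef.zero 1).congr fun x => by simp [pure, PFun.pure]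
  | succ => exact (RegDef.succ 0 1).congr fun x => by simp
  | left =>
    refine (RegDef.pair 2 0 1).ex.congr fun x => ⟨?_, fun h => ?_⟩
    · rintro ⟨b, h⟩
      simp only [push_zero, push_succ] at h
      have h : x 0 = Nat.pair (x 1) b := h
      simp [h]
    · refine ⟨(x 0).unpair.2, ?_⟩
      have h : x 1 = (x 0).unpair.1 := by simpa using h
      change x 0 = Nat.pair (x 1) _
      simp [h]
  | right =>
    refine (RegDef.pair 0 2 1).ex.congr fun x => ⟨?_, fun h => ?_⟩
    · rintro ⟨b, h⟩
      have h : x 0 = Nat.pair b (x 1) := h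
      simp [h]
    · refine ⟨(x 0).unpair.1, ?_⟩
      have h : x 1 = (x 0).unpair.2 := by simpa using h
      change x 0 = Nat.pair _ (x 1)
      simp [h]
  | @pair f g _ _ hf hg =>
    refine ((hf.at_index 2 0).and ((hg.at_index 2 1).and (RegDef.pair 0 1 3))).ex.ex.congr
      fun x => ?_
    simp [Seq.seq]
    exact ⟨fun ⟨b, a, ha, hb, h⟩ => ⟨a, ha, b, hb, h.symm⟩,
      fun ⟨a, ha, b, hb, h⟩ => ⟨b, a, ha, hb, h.symm⟩⟩
  | @comp f g _ _ hf hg =>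
    exact ((hg.at_index 1 0).and (hf.at_index 0 2)).ex.congr fun x => by
      simp only [push_zero, push_succ]
      exact Part.mem_bind_iff.symm
  | prec _ _ hf hg => exact prec hf hg
  | rfind _ hf => exact rfind hf

end GraphDef

/-! ### A universal counter machine -/

theorem Realizable.exists_nat {R : RegConf → RegConf → Prop} (hR : Realizable R) :
    ∃ (E : List (ℕ × RegAct × ℕ)) (s f : ℕ), ∀ d d',
      ReflTransGen (GraphStep RegAct.sem E) (s, d) (f, d') ↔ R d d' := by
  obtain ⟨Q, _, E, s, f, H⟩ := hR
  refine ⟨E.map fun e => (Encodable.encode e.1, e.2.1, Encodable.encode e.2.2),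
    Encodable.encode s, Encodable.encode f, fun d d' =>
      Iff.trans ⟨fun h => ?_, fun h => ?_⟩ (H d d')⟩
  · have key : ∀ c, ReflTransGen (GraphStep RegAct.sem
        (E.map fun e => (Encodable.encode e.1, e.2.1, Encodable.encode e.2.2)))
        (Encodable.encode s, d) c → ∃ q, c.1 = Encodable.encode q ∧
          ReflTransGen (GraphStep RegAct.sem E) (s, d) (q, c.2) := by
      intro c hc
      induction hc with
      | refl => exact ⟨s, rfl, .refl⟩
      | tail _ hs ih =>
        obtain ⟨q, hq, hr⟩ := ih
        obtain ⟨α, hα, hsem⟩ := hs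
        simp only [List.mem_map, Prod.mk.injEq] at hα
        obtain ⟨⟨q₁, α', q₂⟩, he, h1, rfl, h2⟩ := hα
        obtain rfl : q₁ = q := Encodable.encode_injective (h1.trans hq)
        exact ⟨q₂, h2.symm, hr.tail ⟨_, he, hsem⟩⟩
    obtain ⟨q, hq, hr⟩ := key _ h
    cases Encodable.encode_injective hq
    exact hr
  · exact h.lift (p := GraphStep RegAct.sem
      (E.map fun e => (Encodable.encode e.1, e.2.1, Encodable.encode e.2.2)))
      (fun c => (Encodable.encode c.1, c.2))
      (fun c c' ⟨α, hα, hs⟩ => ⟨α, List.mem_map.2 ⟨_, hα, rfl⟩, hs⟩)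

/-- Adding the letter in register `0` to the list that is encoded in register `1`. -/
theorem RealizableOn.storeLetter : RealizableOn 3 fun d d' =>
    d' = (d.set 1 (Nat.pair (d.2 0) (d.2 1) + 1)).set 0 0 := by
  have htest : Testable 4 fun σ => σ 3 = Nat.pair (σ 0) (σ 1) + 1 := by
    refine ((RegDef.pair 1 2 0).and (RegDef.succ 0 3)).ex 4 (push 0 (push 1 fun _ => 3))
      (push_lt (by omega) (push_lt (by omega) (by omega))) |>.congr fun σ => ?_
    simp [push]
  refine ((RealizableOn.guess 3).comp (RealizableOn.comp htest
    (((Realizable.move 1 3 (by omega)).comp (.clear 0)).on 4) ?_) ?_).congr fun d hd d' => ⟨?_, ?_⟩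
  · rintro d d' hd ⟨rfl, -⟩
    exact hd
  · rintro d d' hd ⟨v, rfl⟩
    exact hd.set_succ v
  · rintro ⟨_, ⟨v, rfl⟩, _, ⟨rfl, h⟩, _, rfl, rfl⟩
    have h3 := hd 3 le_rfl
    refine RegConf.ext_snd rfl fun k => ?_
    simp only [RegConf.set_apply] at h ⊢
    simp at h
    split_ifs <;> simp_all
  · rintro rfl
    have h3 := hd 3 le_rfl
    refine ⟨_, ⟨Nat.pair (d.2 0) (d.2 1) + 1, rfl⟩, _, ⟨rfl, ?_⟩, _, rfl, ?_⟩
    · simp [RegConf.set_apply]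
    · refine RegConf.ext_snd rfl fun k => ?_
      simp only [RegConf.set_apply]
      split_ifs <;> simp_all

/-- Reading a word, which is stored in reverse in register `1`. -/
theorem RealizableOn.readWord : RealizableOn 3 (ReflTransGen
    (Relation.Comp RegAct.read.sem
      (fun d d' => d' = (d.set 1 (Nat.pair (d.2 0) (d.2 1) + 1)).set 0 0))) := by
  have hread : ∀ d d', RegConf.Van 3 d → RegAct.read.sem d d' → RegConf.Van 3 d' := by
    rintro d d' hd ⟨a, rfl⟩ i hi
    simpa [Function.update_apply, show i ≠ 0 by omega] using hd i hi
  refine ((((Realizable.act .read).on 3).comp RealizableOn.storeLetter hread)).star ?_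
  rintro d d' hd ⟨e, he, rfl⟩
  exact ((hread _ _ hd he).set (by omega) _).set (by omega) _

/-- The configuration in which `x` has been read by the universal machine for the program `c`. -/
def universalConf (c : Nat.Partrec.Code) (x : List ℕ) : RegConf :=
  (x, Function.update (Function.update 0 2 (Encodable.encode c)) 1 (Encodable.encode x.reverse))

/-- The code of `a :: l` is `Nat.pair a (encode l) + 1`. Prepending is thus a single arithmetic
operation, which is why the word is stored in reverse. -/
theorem readWord_step (c : Nat.Partrec.Code) (x : List ℕ) (d : RegConf) :
    Relation.Comp RegAct.read.sem
      (fun d d' => d' = (d.set 1 (Nat.pair (d.2 0) (d.2 1) + 1)).set 0 0) (universalConf c x) d ↔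
      ∃ a, d = universalConf c (x ++ [a]) := by
  have key (a : ℕ) : ((RegConf.set ((universalConf c x).1 ++ [a],
      Function.update (universalConf c x).2 0 ((universalConf c x).2 0 + a)) 1
      (Nat.pair a (Encodable.encode x.reverse) + 1)).set 0 0) = universalConf c (x ++ [a]) := by
    refine RegConf.ext_snd rfl fun k => ?_
    simp only [universalConf, RegConf.set_apply, Function.update_apply]
    split_ifs <;> simp_all
  constructor
  · rintro ⟨e, ⟨a, rfl⟩, rfl⟩
    refine ⟨a, ?_⟩
    rw [← key]
    simp [universalConf]
  · rintro ⟨a, rfl⟩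
    refine ⟨_, ⟨a, rfl⟩, ?_⟩
    rw [← key]
    simp [universalConf]

theorem readWord_iff (c : Nat.Partrec.Code) (d : RegConf) :
    ReflTransGen (Relation.Comp RegAct.read.sem
      (fun d d' => d' = (d.set 1 (Nat.pair (d.2 0) (d.2 1) + 1)).set 0 0))
      (universalConf c []) d ↔ ∃ x, d = universalConf c x := by
  constructor
  · intro h
    induction h with
    | refl => exact ⟨[], rfl⟩
    | tail _ hs ih =>
      obtain ⟨x, rfl⟩ := ih
      obtain ⟨a, rfl⟩ := (readWord_step c x _).1 hs
      exact ⟨_, rfl⟩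
  · rintro ⟨x, rfl⟩
    induction x using List.reverseRecOn with
    | nil => exact .refl
    | append_singleton x a ih => exact ih.tail ((readWord_step c x _).2 ⟨a, rfl⟩)

/-- A universal program that takes its input reversed. -/
def universalFun (n : ℕ) : Part ℕ :=
  (Denumerable.ofNat Nat.Partrec.Code n.unpair.1).eval
    (Encodable.encode (Denumerable.ofNat (List ℕ) n.unpair.2).reverse)

theorem universalFun_partrec : Nat.Partrec universalFun := by
  refine Partrec.nat_iff.1 (Nat.Partrec.Code.eval_part.comp ?_ ?_)
  · exact (Computable.ofNat _).comp (Computable.fst.comp Computable.unpair)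
  · exact Computable.encode.comp (Computable.list_reverse.comp
      ((Computable.ofNat _).comp (Computable.snd.comp Computable.unpair)))

/-- A fixed counter machine accepts all recursively enumerable languages, with programs given as
initial register contents. -/
theorem exists_universal_graph : ∃ (E : List (ℕ × RegAct × ℕ)) (s f : ℕ),
    ∀ (c : Nat.Partrec.Code) (x : List ℕ),
      (∃ σ, ReflTransGen (GraphStep RegAct.sem E) (s, universalConf c []) (f, (x, σ))) ↔
        (c.eval (Encodable.encode x)).Dom := by
  have htest : Testable 3 fun σ => ∃ b, b ∈ universalFun (Nat.pair (σ 2) (σ 1)) :=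
    (GraphDef.of_partrec universalFun_partrec).at_pair 1 2 0 |>.ex 3 (push 2 fun _ => 1)
      (push_lt (by omega) (by omega))
  have hvan (x : List ℕ) (c : Nat.Partrec.Code) : (universalConf c x).Van 3 := by
    intro i hi
    simp [universalConf, show i ≠ 1 by omega, show i ≠ 2 by omega]
  obtain ⟨R, hR, H⟩ := RealizableOn.readWord
  obtain ⟨S, hS, H'⟩ := htest
  obtain ⟨E, s, f, HE⟩ := (hR.comp hS).exists_nat
  refine ⟨E, s, f, fun c x => ?_⟩
  -- The reversal in `universalFun` undoes the one caused by reading.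
  have hval : universalFun (Nat.pair ((universalConf c x).2 2) ((universalConf c x).2 1)) =
      c.eval (Encodable.encode x) := by
    simp [universalFun, universalConf]
  rw [Part.dom_iff_mem, ← hval]
  constructor
  · rintro ⟨σ, h⟩
    obtain ⟨d, h1, h2⟩ := (HE _ _).1 h
    obtain ⟨y, rfl⟩ := (readWord_iff c d).1 ((H _ (hvan [] c) _).1 h1)
    obtain ⟨h3, h4⟩ := (H' _ (hvan y c) _).1 h2
    obtain rfl : x = y := congrArg Prod.fst h3
    exact h4
  · intro h
    exact ⟨_, (HE _ _).2 ⟨_, (H _ (hvan [] c) _).2 ((readWord_iff c _).2 ⟨x, rfl⟩),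
      (H' _ (hvan x c) (universalConf c x)).2 ⟨rfl, h⟩⟩⟩

/-! ### Machines with a single number as storage -/

/-- An action on a single number: `(y, a, b, c, d)` reads the input word `y` and replaces a number
`a * t + b` by `c * t + d`. -/
abbrev NumAct : Type := List ℕ × ℕ × ℕ × ℕ × ℕ

/-- The meaning of an action on a single number. -/
def NumAct.sem (α : NumAct) (m m' : List ℕ × ℕ) : Prop :=
  m'.1 = m.1 ++ α.1 ∧ ∃ t, m.2 = α.2.1 * t + α.2.2.1 ∧ m'.2 = α.2.2.2.1 * t + α.2.2.2.2

/-- The prime whose exponent holds the contents of a register. -/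
noncomputable def regPrime (i : ℕ) : ℕ := Nat.nth Nat.Prime i

theorem regPrime_prime (i : ℕ) : (regPrime i).Prime := Nat.prime_nth_prime i

theorem regPrime_injective : Function.Injective regPrime :=
  Nat.nth_injective Nat.infinite_setOfPred_prime

/-- The actions on numbers that simulate an action on registers, if the letters are less
than `k`. -/
noncomputable def RegAct.numActs (k : ℕ) : RegAct → List NumAct
  | .skip => [([], 1, 0, 1, 0)]
  | .inc i => [([], 1, 0, regPrime i, 0)]
  | .dec i => [([], regPrime i, 0, 1, 0)]
  | .zero i => (List.range (regPrime i - 1)).map fun r =>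
      ([], regPrime i, r + 1, regPrime i, r + 1)
  | .read => (List.range k).map fun a => ([a], 1, 0, regPrime 0 ^ a, 0)

/-- The graph of actions on numbers that simulates a graph of actions on registers. -/
noncomputable def numEdges (E : List (ℕ × RegAct × ℕ)) (k : ℕ) : List (ℕ × NumAct × ℕ) :=
  E.flatMap fun e => (e.2.1.numActs k).map fun α => (e.1, α, e.2.2)

/-- The number in `m` encodes the register contents in `d`. -/
def EncodesConf (d : RegConf) (m : List ℕ × ℕ) : Prop :=
  d.1 = m.1 ∧ m.2 ≠ 0 ∧ ∀ i, m.2.factorization (regPrime i) = d.2 i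

theorem factorization_regPrime_pow (i e j : ℕ) :
    (regPrime i ^ e).factorization (regPrime j) = if j = i then e else 0 := by
  rw [(regPrime_prime i).factorization_pow, Finsupp.single_apply]
  simp [regPrime_injective.eq_iff, eq_comm]

namespace EncodesConf

variable {d d' : RegConf} {m m' : List ℕ × ℕ}

theorem mul_pow (h : EncodesConf d m) (i a : ℕ) (y : List ℕ) :
    EncodesConf (d.1 ++ y, Function.update d.2 i (d.2 i + a))
      (m.1 ++ y, regPrime i ^ a * m.2) := by
  have hp : regPrime i ^ a ≠ 0 := pow_ne_zero _ (regPrime_prime i).ne_zero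
  refine ⟨by simp [h.1], mul_ne_zero hp h.2.1, fun j => ?_⟩
  rw [Nat.factorization_mul hp h.2.1, Finsupp.add_apply, factorization_regPrime_pow, h.2.2]
  simp only [Function.update_apply]
  split_ifs with hj
  · rw [hj, add_comm]
  · simp

theorem dvd_iff (h : EncodesConf d m) (i : ℕ) : regPrime i ∣ m.2 ↔ d.2 i ≠ 0 := by
  rw [← h.2.2 i, (regPrime_prime i).dvd_iff_one_le_factorization h.2.1, Nat.one_le_iff_ne_zero]

theorem div (h : EncodesConf d m) (i t : ℕ) (ht : m.2 = regPrime i * t) :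
    EncodesConf (d.set i (d.2 i - 1)) (m.1, t) := by
  have ht0 : t ≠ 0 := by
    rintro rfl
    exact h.2.1 ht
  refine ⟨h.1, ht0, fun j => ?_⟩
  have := h.2.2 j
  rw [ht, Nat.factorization_mul (regPrime_prime i).ne_zero ht0, Finsupp.add_apply] at this
  have hp := factorization_regPrime_pow i 1 j
  rw [pow_one] at hp
  rw [hp] at this
  rw [RegConf.set_apply]
  change t.factorization (regPrime j) = _
  by_cases hj : j = i
  · subst hj
    simp only [if_true] at this ⊢
    omega
  · simp only [if_neg hj] at this ⊢
    omega

/-- Incrementing and decrementing become multiplication and division by a prime. The zero test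
becomes a choice among the nonzero residues modulo that prime, each of which leaves the number
unchanged. -/
theorem exists_reg (h : EncodesConf d m) {A : RegAct} {k : ℕ} {α : NumAct}
    (hα : α ∈ A.numActs k) (hs : α.sem m m') : ∃ d', A.sem d d' ∧ EncodesConf d' m' := by
  obtain ⟨x', n'⟩ := m'
  cases A with
  | skip =>
    simp only [RegAct.numActs, List.mem_singleton] at hα
    subst hα
    obtain ⟨h1, t, h2, h3⟩ := hs
    simp only [List.append_nil, one_mul, add_zero] at h1 h2 h3
    refine ⟨d, rfl, ?_⟩
    rwa [h1, h3, ← h2]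
  | inc i =>
    simp only [RegAct.numActs, List.mem_singleton] at hα
    subst hα
    obtain ⟨h1, t, h2, h3⟩ := hs
    simp only [one_mul, add_zero] at h1 h2 h3
    refine ⟨_, rfl, ?_⟩
    rw [h1, h3, ← h2]
    simpa [RegConf.set] using h.mul_pow i 1 []
  | dec i =>
    simp only [RegAct.numActs, List.mem_singleton] at hα
    subst hα
    obtain ⟨h1, t, h2, h3⟩ := hs
    simp only [List.append_nil, one_mul, add_zero] at h1 h2 h3
    refine ⟨_, ⟨(h.dvd_iff i).1 ⟨t, h2⟩, rfl⟩, ?_⟩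
    rw [h1, h3]
    exact h.div i t h2
  | zero i =>
    simp only [RegAct.numActs, List.mem_map, List.mem_range] at hα
    obtain ⟨r, hr, rfl⟩ := hα
    obtain ⟨h1, t, h2, h3⟩ := hs
    simp only [List.append_nil] at h1 h2 h3
    refine ⟨d, ⟨?_, rfl⟩, ?_⟩
    -- Otherwise the prime divides the residue `r + 1`, which is positive and smaller than the
    -- prime.
    · by_contra h0
      have := (h.dvd_iff i).2 h0
      rw [h2, Nat.dvd_add_right (dvd_mul_right _ _)] at this
      have := Nat.le_of_dvd (by omega) this
      omega
    · rwa [h1, h3, ← h2]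
  | read =>
    simp only [RegAct.numActs, List.mem_map, List.mem_range] at hα
    obtain ⟨a, ha, rfl⟩ := hα
    obtain ⟨h1, t, h2, h3⟩ := hs
    simp only [one_mul, add_zero] at h1 h2 h3
    refine ⟨_, ⟨a, rfl⟩, ?_⟩
    rw [h1, h3, ← h2]
    exact h.mul_pow 0 a [a]

theorem exists_num (h : EncodesConf d m) {A : RegAct} {k : ℕ} (hs : A.sem d d')
    (hk : ∀ a ∈ d'.1, a < k) : ∃ α ∈ A.numActs k, ∃ m', α.sem m m' ∧ EncodesConf d' m' := by
  obtain ⟨x, n⟩ := m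
  cases A with
  | skip =>
    cases hs
    exact ⟨_, List.mem_singleton_self _, (x, n), ⟨by simp, n, by simp, by simp⟩, h⟩
  | inc i =>
    cases hs
    refine ⟨_, List.mem_singleton_self _, (x, regPrime i * n), ⟨by simp, n, by simp, by simp⟩, ?_⟩
    simpa [RegConf.set] using h.mul_pow i 1 []
  | dec i =>
    obtain ⟨h0, rfl⟩ := hs
    obtain ⟨t, ht⟩ := (h.dvd_iff i).2 h0
    exact ⟨_, List.mem_singleton_self _, (x, t), ⟨by simp, t, by simpa using ht, by simp⟩,
      h.div i t ht⟩
  | zero i =>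
    obtain ⟨h0, rfl⟩ := hs
    have hd : ¬ regPrime i ∣ n := fun hd => (h.dvd_iff i).1 hd h0
    have hp := (regPrime_prime i).pos
    have hlt := Nat.mod_lt n hp
    have hne : n % regPrime i ≠ 0 := fun hn => hd (Nat.dvd_of_mod_eq_zero hn)
    have hdm := Nat.div_add_mod n (regPrime i)
    refine ⟨_, List.mem_map.2 ⟨n % regPrime i - 1, List.mem_range.2 (by omega), rfl⟩, (x, n),
      ⟨by simp, n / regPrime i, ?_, ?_⟩, h⟩ <;>
    · simp only
      rw [Nat.sub_add_cancel (by omega), hdm]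
  | read =>
    obtain ⟨a, rfl⟩ := hs
    refine ⟨_, List.mem_map.2 ⟨a, List.mem_range.2 (hk a (by simp)), rfl⟩,
      (x ++ [a], regPrime 0 ^ a * n), ⟨by simp, n, by simp, by simp⟩, h.mul_pow 0 a [a]⟩

end EncodesConf

/-- Since the input only grows, a bound on the letters of the final input holds throughout a run;
`numActs k` can only read letters below `k`. -/
theorem RegAct.sem_prefix {A : RegAct} {d d' : RegConf} (h : A.sem d d') : d.1 <+: d'.1 := by
  cases A with
  | skip => cases h; exact List.prefix_rfl
  | inc i => cases h; exact List.prefix_rfl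
  | dec i => obtain ⟨-, rfl⟩ := h; exact List.prefix_rfl
  | zero i => obtain ⟨-, rfl⟩ := h; exact List.prefix_rfl
  | read => obtain ⟨a, rfl⟩ := h; exact List.prefix_append _ _

theorem reachable_numEdges_iff (E : List (ℕ × RegAct × ℕ)) (k s f : ℕ) {d : RegConf}
    {m : List ℕ × ℕ} (h : EncodesConf d m) {x : List ℕ} (hx : ∀ a ∈ x, a < k) :
    (∃ n, ReflTransGen (GraphStep NumAct.sem (numEdges E k)) (s, m) (f, (x, n))) ↔
      ∃ σ, ReflTransGen (GraphStep RegAct.sem E) (s, d) (f, (x, σ)) := by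
  constructor
  · rintro ⟨n, hn⟩
    have key : ∀ c, ReflTransGen (GraphStep NumAct.sem (numEdges E k)) (s, m) c →
        ∃ d', EncodesConf d' c.2 ∧ ReflTransGen (GraphStep RegAct.sem E) (s, d) (c.1, d') := by
      intro c hc
      induction hc with
      | refl => exact ⟨d, h, .refl⟩
      | @tail c c' _ hs ih =>
        obtain ⟨d', hd', hr⟩ := ih
        obtain ⟨α, hα, hsem⟩ := hs
        simp only [numEdges, List.mem_flatMap, List.mem_map, Prod.mk.injEq] at hα
        obtain ⟨⟨q, A, q'⟩, he, α', hα', h1, rfl, h2⟩ := hα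
        obtain ⟨d'', hA, hd''⟩ := hd'.exists_reg hα' hsem
        refine ⟨d'', hd'', hr.tail ⟨A, ?_, hA⟩⟩
        rwa [← h1, ← h2]
    obtain ⟨d', hd', hr⟩ := key _ hn
    obtain ⟨x', σ⟩ := d'
    cases hd'.1
    exact ⟨σ, hr⟩
  · rintro ⟨σ, hσ⟩
    have key : ∀ c, ReflTransGen (GraphStep RegAct.sem E) (s, d) c → (∀ a ∈ c.2.1, a < k) →
        ∃ m', EncodesConf c.2 m' ∧
          ReflTransGen (GraphStep NumAct.sem (numEdges E k)) (s, m) (c.1, m') := by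
      intro c hc
      induction hc with
      | refl => exact fun _ => ⟨m, h, .refl⟩
      | @tail c c' _ hs ih =>
        intro hk
        obtain ⟨A, hA, hsem⟩ := hs
        obtain ⟨m', hm', hr⟩ := ih fun a ha => hk a ((RegAct.sem_prefix hsem).subset ha)
        obtain ⟨α, hα, m'', hs, hm''⟩ := hm'.exists_num hsem hk
        refine ⟨m'', hm'', hr.tail ⟨α, ?_, hs⟩⟩
        exact List.mem_flatMap.2 ⟨_, hA, List.mem_map.2 ⟨α, hα, rfl⟩⟩
    obtain ⟨⟨x', n⟩, hm', hr⟩ := key _ hσ hx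
    cases hm'.1
    exact ⟨n, hr⟩

theorem encodesConf_universalConf_nil (c : Nat.Partrec.Code) :
    EncodesConf (universalConf c []) ([], regPrime 2 ^ Encodable.encode c) := by
  refine ⟨rfl, pow_ne_zero _ (regPrime_prime 2).ne_zero, fun i => ?_⟩
  rw [factorization_regPrime_pow]
  simp only [universalConf, Function.update_apply]
  split_ifs <;> simp_all

/-- A machine with a single number as storage accepts all recursively enumerable languages, with
programs given as initial numbers. -/
theorem exists_universal_numEdges : ∃ (E : List (ℕ × RegAct × ℕ)) (s f : ℕ),
    ∀ (k : ℕ) (c : Nat.Partrec.Code) (x : List ℕ), (∀ a ∈ x, a < k) →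
      ((∃ n, ReflTransGen (GraphStep NumAct.sem (numEdges E k))
        (s, ([], regPrime 2 ^ Encodable.encode c)) (f, (x, n))) ↔
          (c.eval (Encodable.encode x)).Dom) := by
  obtain ⟨E, s, f, H⟩ := exists_universal_graph
  exact ⟨E, s, f, fun k c x hx => (reachable_numEdges_iff E k s f
    (encodesConf_universalConf_nil c) hx).trans (H c x)⟩

/-! ### The product of blocks in a free group -/

/-- The product of the words `a ^ n * b` over the numbers `n` in the list. -/
def blockProd (l : List ℕ) : FreeGroup Bool :=
  (l.map fun n => FreeGroup.of true ^ n * FreeGroup.of false).prod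

theorem blockProd_concat (l : List ℕ) (n : ℕ) :
    blockProd (l ++ [n]) = blockProd l * FreeGroup.of true ^ n * FreeGroup.of false := by
  simp [blockProd, mul_assoc]

/-- The word over the free generators that represents `blockProd`. -/
def blockWord (l : List ℕ) : List (Bool × Bool) :=
  l.flatMap fun n => List.replicate n (true, true) ++ [(false, true)]

theorem blockProd_eq_mk (l : List ℕ) : blockProd l = FreeGroup.mk (blockWord l) := by
  induction l with
  | nil => rfl
  | cons n l ih =>
    have hn : FreeGroup.mk (List.replicate n (true, true)) = FreeGroup.of true ^ n := by
      rw [← FreeGroup.toWord_of_pow, FreeGroup.mk_toWord]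
    have : blockProd (n :: l) = FreeGroup.of true ^ n * FreeGroup.of false * blockProd l := by
      simp [blockProd]
    rw [this, ih, ← hn, FreeGroup.of, FreeGroup.mul_mk, FreeGroup.mul_mk]
    rfl

theorem isReduced_blockWord (l : List ℕ) : FreeGroup.IsReduced (blockWord l) := by
  have : ∀ a ∈ blockWord l, a.2 = true := by
    intro a ha
    simp only [blockWord, List.mem_flatMap, List.mem_append, List.mem_replicate,
      List.mem_singleton] at ha
    obtain ⟨n, -, ⟨-, rfl⟩ | rfl⟩ := ha <;> rfl
  exact List.Pairwise.isChain (List.pairwise_of_forall_mem_list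
    fun a ha b hb _ => (this a ha).trans (this b hb).symm)

theorem blockWord_injective : Function.Injective blockWord := by
  intro l l' h
  induction l generalizing l' with
  | nil =>
    cases l' with
    | nil => rfl
    | cons m l' => simp [blockWord] at h
  | cons n l ih =>
    cases l' with
    | nil => simp [blockWord] at h
    | cons m l' =>
      have h' : List.replicate n (true, true) ++ (false, true) :: blockWord l =
          List.replicate m (true, true) ++ (false, true) :: blockWord l' := by
        simpa [blockWord] using h
      have key : n = m ∧ blockWord l = blockWord l' := by
        clear h
        induction n generalizing m with
        | zero =>
          cases m with
          | zero => simpa using h'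
          | succ m => simp [List.replicate_succ] at h'
        | succ n ihn =>
          cases m with
          | zero => simp [List.replicate_succ] at h'
          | succ m =>
            have := ihn m (by simpa [List.replicate_succ] using h')
            exact ⟨by rw [this.1], this.2⟩
      rw [key.1, ih key.2]

/-- The words for block products contain no inverses, hence are reduced, and equality in the free
group is equality of words. The letter `false` ends each block, so the exponents can be read off. -/
theorem blockProd_injective : Function.Injective blockProd := by
  intro l l' h
  rw [blockProd_eq_mk, blockProd_eq_mk] at h
  have := FreeGroup.reduce.sound h
  rw [(isReduced_blockWord l).reduce_eq, (isReduced_blockWord l').reduce_eq] at this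
  exact blockWord_injective this

/-! ### Homomorphisms from a graph monoid to a free group -/

namespace LoopGraph

variable {V : Type u} (Γ : LoopGraph V)

open Classical in
/-- The image of a generator under the homomorphism that maps `u` to `a`, `v` to `b`, and the other
vertices to `1`. -/
noncomputable def pairGen (u v : V) (x : V × Bool) : FreeGroup Bool :=
  (if x.1 = u then .of true else if x.1 = v then .of false else 1) ^ (if x.2 then (1 : ℤ) else -1)

/-- Only a commutation between `u` and `v` could fail in the free group, and there is no such edge.
Loops do no harm, as powers of one element commute. -/
theorem lift_pairGen_rel {u v : V} (huv : ¬ Γ.deleteLoops.Adj u v) (hne : u ≠ v)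
    (a b : FreeMonoid (V × Bool)) (h : Γ.Rel a b) :
    FreeMonoid.lift (pairGen u v) a = FreeMonoid.lift (pairGen u v) b := by
  cases h with
  | cancel w =>
    simp only [map_mul, map_one, FreeMonoid.lift_eval_of, pairGen]
    rw [← zpow_add]
    simp
  | comm w w' s t h =>
    simp only [map_mul, FreeMonoid.lift_eval_of, pairGen]
    have key (h₁ : Γ.Adj u v) : False := huv ⟨hne, h₁⟩
    by_cases e : w = w'
    · subst e
      rw [← zpow_add, ← zpow_add, add_comm]
    split_ifs <;> subst_vars <;> simp_all <;> exact (key (Γ.symm _ _ h)).elim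

/-- The homomorphism that maps `u` to `a`, `v` to `b`, and the other vertices to `1`. -/
noncomputable def pairHom {u v : V} (huv : ¬ Γ.deleteLoops.Adj u v) (hne : u ≠ v) :
    Γ.GraphMonoid →* FreeGroup Bool :=
  PresentedMonoid.lift (pairGen u v) (Γ.lift_pairGen_rel huv hne)

theorem pairHom_wordClass {u v : V} (huv : ¬ Γ.deleteLoops.Adj u v) (hne : u ≠ v)
    (g : List (V × Bool)) :
    Γ.pairHom huv hne (Γ.wordClass g) = (g.map (pairGen u v)).prod :=
  FreeMonoid.lift_apply _ _

theorem wordClass_append (g g' : List (V × Bool)) :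
    Γ.wordClass (g ++ g') = Γ.wordClass g * Γ.wordClass g' :=
  map_mul (PresentedMonoid.mk Γ.Rel) _ _

theorem wordClass_nil : Γ.wordClass [] = 1 := rfl

/-- A generator of the graph monoid. -/
def gen (v : V) (b : Bool) : Γ.GraphMonoid := Γ.wordClass [(v, b)]

theorem wordClass_cons (x : V × Bool) (g : List (V × Bool)) :
    Γ.wordClass (x :: g) = Γ.gen x.1 x.2 * Γ.wordClass g :=
  Γ.wordClass_append [x] g

theorem wordClass_replicate (n : ℕ) (v : V) (b : Bool) :
    Γ.wordClass (List.replicate n (v, b)) = Γ.gen v b ^ n := by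
  induction n with
  | zero => rfl
  | succ n ih => rw [List.replicate_succ, wordClass_cons, ih, pow_succ']

theorem gen_mul_gen (v : V) : Γ.gen v true * Γ.gen v false = 1 :=
  PresentedMonoid.mk_eq_mk_of_rel (.cancel v)

theorem gen_commute {v w : V} (h : Γ.Adj v w) (b c : Bool) : Commute (Γ.gen v b) (Γ.gen w c) :=
  PresentedMonoid.mk_eq_mk_of_rel (.comm v w b c h)

end LoopGraph

/-! ### Valence automata that simulate machines with a single number -/

/-- Four vertices such that `p, q` and `r, s` are not adjacent, whereas `p` is adjacent to `r` and
`s`, and `q` is adjacent to `s`. -/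
structure LoopGraph.IsQuad {V : Type u} (Γ : LoopGraph V) (p q r s : V) : Prop where
  adj_pr : Γ.Adj p r
  adj_ps : Γ.Adj p s
  adj_qs : Γ.Adj q s
  not_adj_pq : ¬ Γ.deleteLoops.Adj p q
  not_adj_sr : ¬ Γ.deleteLoops.Adj s r
  ne_pq : p ≠ q
  ne_pr : p ≠ r
  ne_ps : p ≠ s
  ne_qr : q ≠ r
  ne_qs : q ≠ s
  ne_sr : s ≠ r

/-- An edge of a machine with a single number as storage. -/
abbrev NumEdge : Type := ℕ × NumAct × ℕ

/-- The states of the simulating automaton. -/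
abbrev SimState : Type := Option (NumEdge ⊕ ℕ)

namespace SimState

/-- The state in which an edge is being simulated. -/
def edge (e : NumEdge) : SimState := some (.inl e)

/-- The state in which the last number is copied. -/
def last : SimState := some (.inr 0)

/-- The state in which the storage is emptied. -/
def empty : SimState := some (.inr 1)

/-- The state that corresponds to a state of the simulated machine. -/
def main (n : ℕ) : SimState := some (.inr (n + 2))

end SimState

/-- An edge of the simulating automaton. -/
abbrev SimEdge (V : Type u) : Type u := SimState × List ℕ × List (V × Bool) × SimState

/-! ### The simulating automaton and its soundness -/

section

variable {V : Type u}

/-- The edges that simulate one edge. -/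
def simEdge (p q r s : V) (e : NumEdge) : List (SimEdge V) :=
  [(.main e.1, e.2.1.1, List.replicate e.2.1.2.2.1 (s, true) ++
      List.replicate e.2.1.2.2.2.2 (p, true), .edge e),
    (.edge e, [], List.replicate e.2.1.2.1 (s, true) ++
      List.replicate e.2.1.2.2.2.1 (p, true), .edge e),
    (.edge e, [], [(r, true), (q, true)], .main e.2.2)]

/-- The edges of the simulating automaton. -/
def simEdges (p q r s : V) (s₀ f n₀ : ℕ) (E : List NumEdge) : List (SimEdge V) :=
  (none, [], List.replicate n₀ (p, true) ++ [(q, true)], .main s₀) ::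
    (.main f, [], [], .last) :: (.last, [], [(s, true)], .last) ::
    (.last, [], [(r, true)], .empty) :: (.empty, [], [(s, false), (p, false)], .empty) ::
    (.empty, [], [(r, false), (q, false)], .empty) :: E.flatMap (simEdge p q r s)

/-- A step of an automaton over a graph monoid that is given by a list of edges. -/
def WordStep {Q : Type*} (Γ : LoopGraph V) (E : List (Q × List ℕ × List (V × Bool) × Q))
    (c c' : Q × List ℕ × Γ.GraphMonoid) : Prop :=
  ∃ y g, (c.1, y, g, c'.1) ∈ E ∧ c'.2.1 = c.2.1 ++ y ∧ c'.2.2 = c.2.2 * Γ.wordClass g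

theorem WordStep.of_mem {Q : Type*} {Γ : LoopGraph V}
    {E : List (Q × List ℕ × List (V × Bool) × Q)} {a b : Q} {y : List ℕ} {g : List (V × Bool)}
    (h : (a, y, g, b) ∈ E) (x : List ℕ) (m : Γ.GraphMonoid) :
    WordStep Γ E (a, x, m) (b, x ++ y, m * Γ.wordClass g) :=
  ⟨y, g, h, rfl, rfl⟩

namespace LoopGraph.IsQuad

variable {Γ : LoopGraph V} {p q r s : V}

/-- What is known about the reachable configurations of the simulating automaton. -/
def Inv (hQ : Γ.IsQuad p q r s) (s₀ f n₀ : ℕ) (E : List NumEdge)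
    (c : SimState × List ℕ × Γ.GraphMonoid) : Prop :=
  let reach := ReflTransGen (GraphStep NumAct.sem E) (s₀, ([], n₀))
  let h₁ := Γ.pairHom hQ.not_adj_pq hQ.ne_pq c.2.2
  let h₂ := Γ.pairHom hQ.not_adj_sr hQ.ne_sr c.2.2
  match c.1 with
  | none => c.2 = ([], 1)
  | some (.inl e) => ∃ (l l' : List ℕ) (k t : ℕ) (y : List ℕ),
      h₁ = blockProd (l ++ [k]) * .of true ^ (e.2.1.2.2.2.1 * t + e.2.1.2.2.2.2) ∧
      h₂ = blockProd l' * .of true ^ (e.2.1.2.1 * t + e.2.1.2.2.1) ∧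
      e ∈ E ∧ c.2.1 = y ++ e.2.1.1 ∧ (l = l' → reach (e.1, (y, k)))
  | some (.inr 0) => ∃ (l l' : List ℕ) (k j : ℕ),
      h₁ = blockProd (l ++ [k]) ∧ h₂ = blockProd l' * .of true ^ j ∧
      (l = l' → reach (f, (c.2.1, k)))
  | some (.inr 1) => ∃ (l l' : List ℕ) (g : FreeGroup Bool),
      h₁ = blockProd l * g ∧ h₂ = blockProd l' * g ∧ (l = l' → ∃ k, reach (f, (c.2.1, k)))
  | some (.inr (n + 2)) => ∃ (l l' : List ℕ) (k : ℕ),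
      h₁ = blockProd (l ++ [k]) ∧ h₂ = blockProd l' ∧ (l = l' → reach (n, (c.2.1, k)))

theorem pairGen_pq (hQ : Γ.IsQuad p q r s) :
    LoopGraph.pairGen p q (p, true) = .of true ∧
    LoopGraph.pairGen p q (q, true) = .of false ∧ LoopGraph.pairGen p q (r, true) = 1 ∧
    LoopGraph.pairGen p q (s, true) = 1 ∧ LoopGraph.pairGen p q (p, false) = (.of true)⁻¹ ∧
    LoopGraph.pairGen p q (q, false) = (.of false)⁻¹ ∧ LoopGraph.pairGen p q (r, false) = 1 ∧
    LoopGraph.pairGen p q (s, false) = 1 := by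
  simp [LoopGraph.pairGen, hQ.ne_pq.symm, hQ.ne_pr.symm, hQ.ne_ps.symm, hQ.ne_qr.symm,
    hQ.ne_qs.symm]

theorem pairGen_sr (hQ : Γ.IsQuad p q r s) :
    LoopGraph.pairGen s r (p, true) = 1 ∧
    LoopGraph.pairGen s r (q, true) = 1 ∧ LoopGraph.pairGen s r (r, true) = .of false ∧
    LoopGraph.pairGen s r (s, true) = .of true ∧ LoopGraph.pairGen s r (p, false) = 1 ∧
    LoopGraph.pairGen s r (q, false) = 1 ∧ LoopGraph.pairGen s r (r, false) = (.of false)⁻¹ ∧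
    LoopGraph.pairGen s r (s, false) = (.of true)⁻¹ := by
  simp [LoopGraph.pairGen, hQ.ne_pr, hQ.ne_ps, hQ.ne_qr, hQ.ne_qs, hQ.ne_sr.symm]

/-- In a main state the first tape reads `l ++ [k]` and the second `l'`, where `k` is the current
number. That `k` is reachable is claimed only if `l = l'`: a wrong guess makes the histories differ
for good, since blocks are only appended until popping starts. While popping, the images are known
up to a common right factor `g`. -/
theorem inv_of_reachable (hQ : Γ.IsQuad p q r s) (s₀ f n₀ : ℕ) (E : List NumEdge)
    (c : SimState × List ℕ × Γ.GraphMonoid)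
    (h : ReflTransGen (WordStep Γ (simEdges p q r s s₀ f n₀ E)) (none, [], 1) c) :
    hQ.Inv s₀ f n₀ E c := by
  obtain ⟨g1, g2, g3, g4, g5, g6, g7, g8⟩ := hQ.pairGen_pq
  obtain ⟨k1, k2, k3, k4, k5, k6, k7, k8⟩ := hQ.pairGen_sr
  induction h with
  | refl => rfl
  | @tail c c' _ hs ih =>
    obtain ⟨a, x, m⟩ := c
    obtain ⟨a', x', m'⟩ := c'
    obtain ⟨y, g, he, hx, hm⟩ := hs
    simp only at he hx hm
    subst hx hm
    simp only [simEdges, simEdge, List.mem_cons, List.mem_flatMap, List.not_mem_nil, or_false,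
      Prod.mk.injEq] at he
    rcases he with ⟨rfl, rfl, rfl, rfl⟩ | ⟨rfl, rfl, rfl, rfl⟩ | ⟨rfl, rfl, rfl, rfl⟩ |
      ⟨rfl, rfl, rfl, rfl⟩ | ⟨rfl, rfl, rfl, rfl⟩ | ⟨rfl, rfl, rfl, rfl⟩ |
      ⟨e, heE, ⟨rfl, rfl, rfl, rfl⟩ | ⟨rfl, rfl, rfl, rfl⟩ | ⟨rfl, rfl, rfl, rfl⟩⟩
    · cases ih
      refine ⟨[], [], n₀, ?_, ?_, fun _ => .refl⟩ <;>
        simp [LoopGraph.pairHom_wordClass, blockProd, *]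
    · obtain ⟨l, l', k, h1, h2, h3⟩ := ih
      refine ⟨l, l', k, 0, ?_, ?_, ?_⟩
      · simpa [LoopGraph.wordClass_nil] using h1
      · simpa [LoopGraph.wordClass_nil] using h2
      · simpa using h3
    · obtain ⟨l, l', k, j, h1, h2, h3⟩ := ih
      refine ⟨l, l', k, j + 1, ?_, ?_, ?_⟩
      · simpa [LoopGraph.pairHom_wordClass, g4] using h1
      · simp only [map_mul, LoopGraph.pairHom_wordClass, List.map_cons, k4, List.map_nil,
          List.prod_singleton, pow_succ, ← mul_assoc]
        rw [← h2]
      · simpa using h3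
    · obtain ⟨l, l', k, j, h1, h2, h3⟩ := ih
      refine ⟨l ++ [k], l' ++ [j], 1, ?_, ?_, ?_⟩
      · simpa [LoopGraph.pairHom_wordClass, g3] using h1
      · simp only [map_mul, LoopGraph.pairHom_wordClass, List.map_cons, k3, List.map_nil,
          List.prod_singleton, blockProd_concat, mul_one]
        rw [← h2]
      · intro h
        simp only [List.append_nil]
        exact ⟨k, h3 (List.append_inj_left' h rfl)⟩
    · obtain ⟨l, l', g, h1, h2, h3⟩ := ih
      -- `ā_s` is invisible on the first tape and `ā_p` on the second, and each contributes the same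
      -- inverse to its own tape.
      refine ⟨l, l', g * (.of true)⁻¹, ?_, ?_, by simpa using h3⟩
      · simp only [map_mul, LoopGraph.pairHom_wordClass, List.map_cons, g8, g5, List.map_nil,
          List.prod_cons, List.prod_nil, mul_one, one_mul, ← mul_assoc]
        rw [← h1]
      · simp only [map_mul, LoopGraph.pairHom_wordClass, List.map_cons, k8, k5, List.map_nil,
          List.prod_cons, List.prod_nil, mul_one, ← mul_assoc]
        rw [← h2]
    · obtain ⟨l, l', g, h1, h2, h3⟩ := ih
      refine ⟨l, l', g * (.of false)⁻¹, ?_, ?_, by simpa using h3⟩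
      · simp only [map_mul, LoopGraph.pairHom_wordClass, List.map_cons, g7, g6, List.map_nil,
          List.prod_cons, List.prod_nil, mul_one, one_mul, ← mul_assoc]
        rw [← h1]
      · simp only [map_mul, LoopGraph.pairHom_wordClass, List.map_cons, k7, k6, List.map_nil,
          List.prod_cons, List.prod_nil, mul_one, ← mul_assoc]
        rw [← h2]
    · obtain ⟨l, l', k, h1, h2, h3⟩ := ih
      refine ⟨l, l', k, 0, x, ?_, ?_, heE, rfl, h3⟩
      · simp only [map_mul, LoopGraph.pairHom_wordClass, List.map_append, List.map_replicate, g4,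
          g1, List.prod_append, List.prod_replicate, one_pow, one_mul, mul_zero, zero_add]
        rw [← h1]
      · simp only [map_mul, LoopGraph.pairHom_wordClass, List.map_append, List.map_replicate, k4,
          k1, List.prod_append, List.prod_replicate, one_pow, mul_one, mul_zero, zero_add]
        rw [← h2]
    · obtain ⟨l, l', k, t, y, h1, h2, h3, h4, h5⟩ := ih
      refine ⟨l, l', k, t + 1, y, ?_, ?_, heE, by simpa using h4, h5⟩
      · simp only [map_mul, LoopGraph.pairHom_wordClass, List.map_append, List.map_replicate, g4,
          g1, List.prod_append, List.prod_replicate, one_pow, one_mul]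
        rw [h1, mul_assoc, ← pow_add]
        congr 2
        ring
      · simp only [map_mul, LoopGraph.pairHom_wordClass, List.map_append, List.map_replicate, k4,
          k1, List.prod_append, List.prod_replicate, one_pow, mul_one]
        rw [h2, mul_assoc, ← pow_add]
        congr 2
        ring
    · obtain ⟨l, l', k, t, y, h1, h2, h3, h4, h5⟩ := ih
      refine ⟨l ++ [k], l' ++ [e.2.1.2.1 * t + e.2.1.2.2.1],
        e.2.1.2.2.2.1 * t + e.2.1.2.2.2.2, ?_, ?_, ?_⟩
      · simp only [map_mul, LoopGraph.pairHom_wordClass, List.map_cons, g3, g2, List.map_nil,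
          List.prod_cons, List.prod_nil, mul_one, one_mul]
        rw [h1, blockProd_concat _ (_ + _)]
      · simp only [map_mul, LoopGraph.pairHom_wordClass, List.map_cons, k3, k2, List.map_nil,
          List.prod_cons, List.prod_nil, mul_one]
        rw [h2, blockProd_concat]
      · intro h
        have hl := List.append_inj_left' h rfl
        -- Equality of the extended histories says that the guessed `t` fits the current number,
        -- which is the precondition of the action.
        have hk : k = e.2.1.2.1 * t + e.2.1.2.2.1 := by
          simpa using List.append_inj_right' h rfl
        simp only at h4
        simp only [List.append_nil, h4]
        exact (h5 hl).tail ⟨e.2.1, h3, rfl, t, hk, rfl⟩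

/-- With storage `1` both images are trivial, so both block products are the inverse of the common
factor `g`, and the histories agree. -/
theorem exists_reach_of_accepts (hQ : Γ.IsQuad p q r s)
    (s₀ f n₀ : ℕ) (E : List NumEdge) (x : List ℕ)
    (h : ReflTransGen (WordStep Γ (simEdges p q r s s₀ f n₀ E)) (none, [], 1)
      (.empty, x, 1)) :
    ∃ n, ReflTransGen (GraphStep NumAct.sem E) (s₀, ([], n₀)) (f, (x, n)) := by
  obtain ⟨l, l', g, h1, h2, h3⟩ := hQ.inv_of_reachable s₀ f n₀ E _ h
  refine h3 (blockProd_injective ?_)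
  simp only [map_one] at h1 h2
  exact mul_right_cancel (h1.symm.trans h2)

end LoopGraph.IsQuad

end

/-! ### Completeness of the simulation -/

section

variable {V : Type u}

namespace LoopGraph

/-- The product of the storage elements `(a_p a_s) ^ n * a_q a_r` over the numbers in a list. -/
def sync (Γ : LoopGraph V) (p q r s : V) (l : List ℕ) : Γ.GraphMonoid :=
  (l.map fun n => (Γ.gen p true * Γ.gen s true) ^ n * (Γ.gen q true * Γ.gen r true)).prod

theorem sync_concat (Γ : LoopGraph V) (p q r s : V) (l : List ℕ) (n : ℕ) :
    Γ.sync p q r s (l ++ [n]) = Γ.sync p q r s l *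
      ((Γ.gen p true * Γ.gen s true) ^ n * (Γ.gen q true * Γ.gen r true)) := by
  simp [sync]

namespace IsQuad

variable {Γ : LoopGraph V} {p q r s : V}

/-- A block written on the first tape and then on the second can be interleaved because `a_s`
commutes with `a_p` and `a_q`. The letter `a_r` stays behind `a_q`, so nothing is needed about these
two. -/
theorem sync_concat_eq (hQ : Γ.IsQuad p q r s) (l : List ℕ) (n : ℕ) :
    Γ.sync p q r s (l ++ [n]) = Γ.sync p q r s l * Γ.gen p true ^ n * Γ.gen q true *
      Γ.gen s true ^ n * Γ.gen r true := by
  have h₁ := (Γ.gen_commute hQ.adj_ps true true).mul_pow n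
  have h₂ := ((Γ.gen_commute hQ.adj_qs true true).pow_right n).eq
  rw [sync_concat, h₁]
  simp only [mul_assoc]
  rw [← mul_assoc (Γ.gen q true), h₂, mul_assoc]

variable (s₀ f n₀ : ℕ) (E : List NumEdge)

/-- If all guesses are right, the storage is the synchronized history before the current number,
followed by the block of that number on the first tape alone. -/
theorem exists_main (hQ : Γ.IsQuad p q r s) (c : ℕ × List ℕ × ℕ)
    (h : ReflTransGen (GraphStep NumAct.sem E) (s₀, ([], n₀)) c) :
    ∃ l, ReflTransGen (WordStep Γ (simEdges p q r s s₀ f n₀ E)) (none, [], 1)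
      (.main c.1, c.2.1, Γ.sync p q r s l * Γ.gen p true ^ c.2.2 * Γ.gen q true) := by
  induction h with
  | refl =>
    refine ⟨[], .single ⟨[], _, List.mem_cons_self, rfl, ?_⟩⟩
    simp [sync, wordClass_append, wordClass_replicate, gen]
  | @tail c c' _ hs ih =>
    obtain ⟨l, hl⟩ := ih
    obtain ⟨i, x, n⟩ := c
    obtain ⟨i', x', n'⟩ := c'
    obtain ⟨α, hα, hx, t, hn, hn'⟩ := hs
    simp only at hα hx hn hn' hl
    subst hx
    have mem (e' : SimEdge V) (he' : e' ∈ simEdge p q r s (i, α, i')) :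
        e' ∈ simEdges p q r s s₀ f n₀ E := by
      simp only [simEdges, List.mem_cons, List.mem_flatMap]
      exact .inr (.inr (.inr (.inr (.inr (.inr ⟨_, hα, he'⟩)))))
    have hps := Γ.gen_commute hQ.adj_ps true true
    have loop : ∀ t m, ReflTransGen (WordStep Γ (simEdges p q r s s₀ f n₀ E))
        (.edge (i, α, i'), x ++ α.1, m) (.edge (i, α, i'), x ++ α.1,
          m * (Γ.gen s true ^ (α.2.1 * t) * Γ.gen p true ^ (α.2.2.2.1 * t))) := by
      intro t
      induction t with
      | zero => intro m; simpa using .refl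
      | succ t ih =>
        intro m
        refine (ih m).tail ⟨[], _, mem _ (List.mem_cons_of_mem _ List.mem_cons_self), by simp, ?_⟩
        simp only [wordClass_append, wordClass_replicate, mul_assoc]
        congr 1
        rw [← mul_assoc (Γ.gen p true ^ _), (hps.pow_pow _ _).eq, mul_assoc, ← pow_add,
          ← mul_assoc, ← pow_add]
        rfl
    have first := WordStep.of_mem (Γ := Γ) (mem _ List.mem_cons_self) x
      (Γ.sync p q r s l * Γ.gen p true ^ n * Γ.gen q true)
    have final := fun m => WordStep.of_mem (Γ := Γ) (mem _ (List.mem_cons_of_mem _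
      (List.mem_cons_of_mem _ List.mem_cons_self))) (x ++ α.1) m
    refine ⟨l ++ [n], ?_⟩
    have run := ((hl.tail first).trans (loop t _)).tail (final _)
    simp only [List.append_nil] at run
    convert run using 3
    rw [hQ.sync_concat_eq, hn, hn']
    simp only [wordClass_append, wordClass_replicate, wordClass_cons, wordClass_nil, mul_one,
      mul_assoc]
    congr 3
    -- The new powers of `a_p` precede `a_r` in the run but belong to the next block, so they are
    -- moved past it.
    have hpr := (Γ.gen_commute hQ.adj_pr true true)
    rw [← mul_assoc (Γ.gen p true ^ α.2.2.2.2), (hps.pow_pow _ _).eq, mul_assoc,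
      ← mul_assoc (Γ.gen p true ^ α.2.2.2.2), ← pow_add, ← mul_assoc (Γ.gen s true ^ α.2.2.1),
      ← pow_add, ← mul_assoc (Γ.gen p true ^ (α.2.2.2.2 + α.2.2.2.1 * t)),
      (hpr.pow_left _).eq, add_comm α.2.2.1, add_comm α.2.2.2.2]
    simp only [mul_assoc]

/-- From the right, `a_q * a_r` cancels against `ā_r * ā_q`, and each `a_p * a_s` against `ā_s *
ā_p`. Only `a * ā = 1` is used, no commutation. -/
theorem empties (l : List ℕ) (x : List ℕ) :
    ReflTransGen (WordStep Γ (simEdges p q r s s₀ f n₀ E)) (.empty, x, Γ.sync p q r s l)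
      (.empty, x, 1) := by
  have hps : Γ.gen p true * Γ.gen s true * Γ.wordClass [(s, false), (p, false)] = 1 := by
    rw [wordClass_cons, wordClass_cons, wordClass_nil, mul_one, mul_assoc,
      ← mul_assoc (Γ.gen s true), gen_mul_gen, one_mul, gen_mul_gen]
  have hqr : Γ.gen q true * Γ.gen r true * Γ.wordClass [(r, false), (q, false)] = 1 := by
    rw [wordClass_cons, wordClass_cons, wordClass_nil, mul_one, mul_assoc,
      ← mul_assoc (Γ.gen r true), gen_mul_gen, one_mul, gen_mul_gen]
  induction l using List.reverseRecOn with
  | nil => exact .refl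
  | append_singleton l n ih =>
    have undo : ∀ n, ReflTransGen (WordStep Γ (simEdges p q r s s₀ f n₀ E))
        (.empty, x, Γ.sync p q r s l * (Γ.gen p true * Γ.gen s true) ^ n)
        (.empty, x, Γ.sync p q r s l) := by
      intro n
      induction n with
      | zero => simpa using .refl
      | succ n ihn =>
        refine .head ⟨[], [(s, false), (p, false)], by simp [simEdges], by simp, ?_⟩ ihn
        simp only [pow_succ, mul_assoc] at hps ⊢
        rw [hps, mul_one]
    refine .head ⟨[], [(r, false), (q, false)], by simp [simEdges], by simp, ?_⟩
      ((undo n).trans ih)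
    simp only [sync_concat, mul_assoc] at hqr ⊢
    rw [hqr, mul_one]

theorem accepts_iff (hQ : Γ.IsQuad p q r s) (x : List ℕ) :
    ReflTransGen (WordStep Γ (simEdges p q r s s₀ f n₀ E)) (none, [], 1) (.empty, x, 1) ↔
      ∃ n, ReflTransGen (GraphStep NumAct.sem E) (s₀, ([], n₀)) (f, (x, n)) := by
  refine ⟨hQ.exists_reach_of_accepts s₀ f n₀ E x, ?_⟩
  rintro ⟨n, hn⟩
  obtain ⟨l, hl⟩ := hQ.exists_main s₀ f n₀ E _ hn
  simp only at hl
  have copy : ∀ j m, ReflTransGen (WordStep Γ (simEdges p q r s s₀ f n₀ E))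
      (.last, x, m) (.last, x, m * Γ.gen s true ^ j) := by
    intro j m
    induction j with
    | zero => simpa using .refl
    | succ j ih =>
      exact ih.tail ⟨[], [(s, true)], by simp [simEdges], by simp, by
        rw [pow_succ, mul_assoc]; rfl⟩
  have step₁ : WordStep Γ (simEdges p q r s s₀ f n₀ E)
      (.main f, x, Γ.sync p q r s l * Γ.gen p true ^ n * Γ.gen q true)
      (.last, x, Γ.sync p q r s l * Γ.gen p true ^ n * Γ.gen q true) :=
    ⟨[], [], by simp [simEdges], by simp, by simp [wordClass_nil]⟩
  have step₂ : WordStep Γ (simEdges p q r s s₀ f n₀ E)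
      (.last, x, Γ.sync p q r s l * Γ.gen p true ^ n * Γ.gen q true * Γ.gen s true ^ n)
      (.empty, x, Γ.sync p q r s (l ++ [n])) :=
    ⟨[], [(r, true)], by simp [simEdges], by simp, by rw [hQ.sync_concat_eq]; rfl⟩
  exact (((hl.tail step₁).trans (copy n _)).tail step₂).trans
    (empties s₀ f n₀ E (l ++ [n]) x)

end IsQuad

end LoopGraph

end

/-! ### Descriptions of the simulating automata -/

section

variable {V : Type u}

/-- The description of the automaton with the given edges, whose states are numbered by their
codes. -/
def SimEdge.toCode (E : List (SimEdge V)) : ValenceCode V where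
  lastState := (E.map fun e => Encodable.encode e.1 + Encodable.encode e.2.2.2).sum
  edges := E.map fun e => (Encodable.encode e.1, e.2.1, e.2.2.1, Encodable.encode e.2.2.2)
  final := [Encodable.encode SimState.empty]

theorem SimEdge.encode_le_lastState {E : List (SimEdge V)} {e : SimEdge V} (he : e ∈ E) :
    Encodable.encode e.1 + Encodable.encode e.2.2.2 ≤ (SimEdge.toCode E).lastState :=
  List.single_le_sum (fun _ _ => Nat.zero_le _) _ (List.mem_map.2 ⟨e, he, rfl⟩)

/-- The initial state `none` has code `0`, as a description requires. As `lastState` is the sum of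
all codes of states on edges, it bounds each of them, and no listed edge is ignored because of its
states. -/
theorem SimEdge.mem_language_toCode (Γ : LoopGraph V) (k : ℕ) (E : List (SimEdge V))
    (x : List (Fin k)) : x ∈ ((SimEdge.toCode E).toAutomaton Γ k).language ↔
      ReflTransGen (WordStep Γ E) (none, [], 1) (.empty, x.map Fin.val, 1) := by
  constructor
  · rintro ⟨f, hf, h⟩
    have key : ∀ c, ReflTransGen ((SimEdge.toCode E).toAutomaton Γ k).Step
        (((SimEdge.toCode E).toAutomaton Γ k).init, [], 1) c →
        ∃ q : SimState, (show Fin _ from c.1).val = Encodable.encode q ∧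
          ReflTransGen (WordStep Γ E) (none, [], 1) (q, c.2.1.map Fin.val, c.2.2) := by
      intro c hc
      induction hc with
      | refl => exact ⟨none, rfl, .refl⟩
      | @tail c c' _ hs ih =>
        obtain ⟨q, hq, hr⟩ := ih
        obtain ⟨y, n, ⟨g, hg, hn⟩, hy, hm⟩ := hs
        simp only [SimEdge.toCode, List.mem_map, Prod.mk.injEq] at hg
        obtain ⟨⟨q₁, y', g', q₂⟩, he, h1, h2, h3, h4⟩ := hg
        simp only at h1 h2 h3 h4 hn
        obtain rfl : q₁ = q := Encodable.encode_injective (h1.trans hq)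
        subst h2 h3
        exact ⟨q₂, h4.symm, hr.tail ⟨_, _, he, by simp [hy], by rw [hm, hn]⟩⟩
    obtain ⟨q, hq, hr⟩ := key _ h
    have hf' : (show Fin _ from f).val = Encodable.encode SimState.empty := List.mem_singleton.1 hf
    obtain rfl : q = .empty := Encodable.encode_injective (hq.symm.trans hf')
    exact hr
  · intro h
    have key : ∀ c, ReflTransGen (WordStep Γ E) (none, [], 1) c →
        ∀ x : List (Fin k), c.2.1 = x.map Fin.val →
          ∃ hlt : Encodable.encode c.1 < (SimEdge.toCode E).lastState + 1,
            ReflTransGen ((SimEdge.toCode E).toAutomaton Γ k).Step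
              (((SimEdge.toCode E).toAutomaton Γ k).init, [], 1)
              ((⟨Encodable.encode c.1, hlt⟩ : Fin _), x, c.2.2) := by
      intro c hc
      induction hc with
      | refl =>
        intro x hx
        obtain rfl : x = [] := by simpa using hx.symm
        exact ⟨Nat.succ_pos _, .refl⟩
      | @tail c c' _ hs ih =>
        intro x hx
        obtain ⟨y, g, he, hy, hm⟩ := hs
        obtain ⟨x₁, x₂, rfl, h1, h2⟩ := List.append_eq_map_iff.1 (hy.symm.trans hx)
        obtain ⟨hlt, hr⟩ := ih x₁ h1.symm
        have hle := SimEdge.encode_le_lastState he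
        refine ⟨by simp only at hle; omega, hr.tail ⟨x₂, Γ.wordClass g, ⟨g, ?_, rfl⟩, rfl, hm⟩⟩
        exact List.mem_map.2 ⟨_, he, by simp [h2]⟩
    obtain ⟨hlt, hr⟩ := key _ h x rfl
    exact ⟨_, List.mem_singleton_self _, hr⟩

end

/-! ### Computability of the construction -/

theorem Primrec.nat_pow : Primrec₂ ((· ^ ·) : ℕ → ℕ → ℕ) :=
  Primrec₂.unpaired'.1 Nat.Primrec.pow

theorem Primrec.list_replicate {α : Type*} [Primcodable α] :
    Primrec₂ (List.replicate : ℕ → α → List α) := by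
  refine Primrec.of_eq (f := fun p : ℕ × α => (List.range p.1).map fun _ => p.2)
    (Primrec.list_map (Primrec.list_range.comp Primrec.fst) (Primrec.snd.comp Primrec.fst).to₂)
    fun p => by simp

theorem Primrec.list_sum : Primrec (List.sum : List ℕ → ℕ) :=
  (Primrec.list_foldr Primrec.id (Primrec.const 0) (Primrec.nat_add.comp
    (Primrec.fst.comp Primrec.snd) (Primrec.snd.comp Primrec.snd)).to₂).of_eq fun _ => rfl

/-- For a fixed graph `E` the primes that occur are constants, so it does not matter how `regPrime`
is defined; only `k` varies. -/
theorem primrec_numEdges (E : List (ℕ × RegAct × ℕ)) : Primrec (numEdges E) := by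
  induction E with
  | nil => exact Primrec.const []
  | cons e E ih =>
    have hacts : Primrec fun k => e.2.1.numActs k := by
      cases e.2.1 with
      | skip => exact Primrec.const _
      | inc i => exact Primrec.const _
      | dec i => exact Primrec.const _
      | zero i => exact Primrec.const _
      | read =>
        refine Primrec.list_map Primrec.list_range (Primrec₂.mk ?_)
        exact Primrec.pair (Primrec.list_cons.comp Primrec.snd (Primrec.const []))
          (Primrec.pair (Primrec.const 1) (Primrec.pair (Primrec.const 0)
            (Primrec.pair (Primrec.nat_pow.comp (Primrec.const _) Primrec.snd) (Primrec.const 0))))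
    refine (Primrec.list_append.comp (Primrec.list_map hacts
      (g := fun _ α => (e.1, α, e.2.2)) (Primrec₂.mk ?_)) ih).of_eq fun k => by simp [numEdges]
    exact Primrec.pair (Primrec.const _) (Primrec.pair Primrec.snd (Primrec.const _))

section

variable {V : Type u} [Primcodable V]

theorem primrec_simEdge (p q r s : V) : Primrec (simEdge p q r s) := by
  have e1 : Primrec fun e : NumEdge => e.1 := Primrec.fst
  have e2 : Primrec fun e : NumEdge => e.2.2 := Primrec.snd.comp Primrec.snd
  have α : Primrec fun e : NumEdge => e.2.1 := Primrec.fst.comp Primrec.snd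
  have α1 : Primrec fun e : NumEdge => e.2.1.1 := Primrec.fst.comp α
  have α' : Primrec fun e : NumEdge => e.2.1.2 := Primrec.snd.comp α
  have αa : Primrec fun e : NumEdge => e.2.1.2.1 := Primrec.fst.comp α'
  have αb : Primrec fun e : NumEdge => e.2.1.2.2.1 := Primrec.fst.comp (Primrec.snd.comp α')
  have αc : Primrec fun e : NumEdge => e.2.1.2.2.2.1 :=
    Primrec.fst.comp (Primrec.snd.comp (Primrec.snd.comp α'))
  have αd : Primrec fun e : NumEdge => e.2.1.2.2.2.2 :=
    Primrec.snd.comp (Primrec.snd.comp (Primrec.snd.comp α'))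
  have main : Primrec SimState.main :=
    Primrec.option_some.comp (Primrec.sumInr.comp
      (Primrec.nat_add.comp Primrec.id (Primrec.const 2)))
  have edge : Primrec SimState.edge := Primrec.option_some.comp Primrec.sumInl
  have rep {f : NumEdge → ℕ} (hf : Primrec f) (x : V × Bool) :
      Primrec fun e => List.replicate (f e) x := Primrec.list_replicate.comp hf (Primrec.const x)
  refine Primrec.list_cons.comp ?_ (Primrec.list_cons.comp ?_ (Primrec.list_cons.comp ?_
    (Primrec.const [])))
  · exact Primrec.pair (main.comp e1) (Primrec.pair α1 (Primrec.pair
      (Primrec.list_append.comp (rep αb _) (rep αd _)) edge))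
  · exact Primrec.pair edge (Primrec.pair (Primrec.const _) (Primrec.pair
      (Primrec.list_append.comp (rep αa _) (rep αc _)) edge))
  · exact Primrec.pair edge (Primrec.pair (Primrec.const _) (Primrec.pair
      (Primrec.const _) (main.comp e2)))

theorem primrec_simEdges (p q r s : V) (s₀ f : ℕ) : Primrec₂ (simEdges p q r s s₀ f) := by
  refine Primrec.list_cons.comp ?_ (Primrec.list_cons.comp (Primrec.const _)
    (Primrec.list_cons.comp (Primrec.const _) (Primrec.list_cons.comp (Primrec.const _)
      (Primrec.list_cons.comp (Primrec.const _) (Primrec.list_cons.comp (Primrec.const _) ?_)))))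
  · exact Primrec.pair (Primrec.const _) (Primrec.pair (Primrec.const _) (Primrec.pair
      (Primrec.list_append.comp (Primrec.list_replicate.comp Primrec.fst (Primrec.const _))
        (Primrec.const _)) (Primrec.const _)))
  · exact Primrec.list_flatMap Primrec.snd ((primrec_simEdge p q r s).comp Primrec.snd).to₂

theorem primrec_toCode : Primrec (SimEdge.toCode : List (SimEdge V) → ValenceCode V) := by
  have h1 : Primrec fun e : SimEdge V => Encodable.encode e.1 := Primrec.encode.comp Primrec.fst
  have h2 : Primrec fun e : SimEdge V => Encodable.encode e.2.2.2 :=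
    Primrec.encode.comp (Primrec.snd.comp (Primrec.snd.comp Primrec.snd))
  have h3 : Primrec fun e : SimEdge V =>
      (Encodable.encode e.1, e.2.1, e.2.2.1, Encodable.encode e.2.2.2) :=
    Primrec.pair h1 (Primrec.pair (Primrec.fst.comp Primrec.snd) (Primrec.pair
      (Primrec.fst.comp (Primrec.snd.comp Primrec.snd)) h2))
  exact ((Primrec.of_equiv_symm (e := ValenceCode.equivProd V)).comp (Primrec.pair
    (Primrec.list_sum.comp (Primrec.list_map Primrec.id
      ((Primrec.nat_add.comp h1 h2).comp Primrec.snd).to₂)) (Primrec.pair (Primrec.list_map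
        Primrec.id (h3.comp Primrec.snd).to₂)
        (Primrec.const [Encodable.encode SimState.empty])))).of_eq fun E => rfl

/-- Universality pays off here: `E` does not depend on `c`, which only determines the number of
letters `a_p` on the first edge. -/
theorem LoopGraph.IsQuad.exists_code_to_automaton {Γ : LoopGraph V} {p q r s : V}
    (hQ : Γ.IsQuad p q r s) : ∃ g : ℕ → Nat.Partrec.Code → ValenceCode V, Computable₂ g ∧
      ∀ k c, ((g k c).toAutomaton Γ k).language = reLanguage k c := by
  obtain ⟨E, s₀, f, H⟩ := exists_universal_numEdges
  refine ⟨fun k c => SimEdge.toCode (simEdges p q r s s₀ f (regPrime 2 ^ Encodable.encode c)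
    (numEdges E k)), Primrec.to_comp ?_, fun k c => ?_⟩
  · exact primrec_toCode.comp ((primrec_simEdges p q r s s₀ f).comp
      (Primrec.nat_pow.comp (Primrec.const _) (Primrec.encode.comp Primrec.snd))
      ((primrec_numEdges E).comp Primrec.fst))
  · ext x
    rw [SimEdge.mem_language_toCode, hQ.accepts_iff, H k c _ (by simp)]
    rfl

end

/-- In the cycle, `p, q` and `r, s` are the pairs of opposite corners; the path is traversed as `r,
p, s, q`. -/
theorem LoopGraph.exists_isQuad {V : Type u} (Γ : LoopGraph V)
    (hΓ : (SimpleGraph.cycleGraph 4).IsIndContained Γ.deleteLoops ∨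
      (SimpleGraph.pathGraph 4).IsIndContained Γ.deleteLoops) :
    ∃ p q r s, Γ.IsQuad p q r s := by
  rcases hΓ with ⟨⟨φ⟩⟩ | ⟨⟨φ⟩⟩
  · have adj (i j : Fin 4) (h : (SimpleGraph.cycleGraph 4).Adj i j) : Γ.Adj (φ i) (φ j) :=
      (φ.map_rel_iff.2 h).2
    have nadj (i j : Fin 4) (h : ¬ (SimpleGraph.cycleGraph 4).Adj i j) :
        ¬ Γ.deleteLoops.Adj (φ i) (φ j) := fun h' => h (φ.map_rel_iff.1 h')
    have ne (i j : Fin 4) (h : i ≠ j) : φ i ≠ φ j := fun h' => h (φ.injective h')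
    refine ⟨φ 0, φ 2, φ 1, φ 3, ⟨adj _ _ ?_, adj _ _ ?_, adj _ _ ?_, nadj _ _ ?_, nadj _ _ ?_,
      ne _ _ ?_, ne _ _ ?_, ne _ _ ?_, ne _ _ ?_, ne _ _ ?_, ne _ _ ?_⟩⟩ <;> decide
  · have adj (i j : Fin 4) (h : (SimpleGraph.pathGraph 4).Adj i j) : Γ.Adj (φ i) (φ j) :=
      (φ.map_rel_iff.2 h).2
    have nadj (i j : Fin 4) (h : ¬ (SimpleGraph.pathGraph 4).Adj i j) :
        ¬ Γ.deleteLoops.Adj (φ i) (φ j) := fun h' => h (φ.map_rel_iff.1 h')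
    have ne (i j : Fin 4) (h : i ≠ j) : φ i ≠ φ j := fun h' => h (φ.injective h')
    refine ⟨φ 1, φ 3, φ 0, φ 2, ⟨adj _ _ ?_, adj _ _ ?_, adj _ _ ?_, nadj _ _ ?_, nadj _ _ ?_,
      ne _ _ ?_, ne _ _ ?_, ne _ _ ?_, ne _ _ ?_, ne _ _ ?_, ne _ _ ?_⟩⟩ <;>
      simp [SimpleGraph.pathGraph_adj]

/-! ### Valence automata accept recursively enumerable languages -/

/-- Unbounded search through all codes of possible `b`. -/
theorem REPred.exists_of_primrecRel {α β : Type*} [Primcodable α] [Primcodable β]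
    {p : α → β → Prop} (hp : PrimrecRel p) : REPred fun a => ∃ b, p a b := by
  classical
  let F : α → ℕ → Option Unit := fun a n =>
    (Encodable.decode (α := β) n).bind fun b => if p a b then some () else none
  have hF : Primrec₂ F := by
    refine Primrec.option_bind (Primrec.decode.comp Primrec.snd) (Primrec₂.mk ?_)
    exact Primrec.ite (hp.comp (Primrec.fst.comp Primrec.fst) Primrec.snd)
      (Primrec.const _) (Primrec.const _)
  refine (Partrec.dom_re (Partrec.rfindOpt hF.to_comp)).of_eq fun a => ?_
  rw [Nat.rfindOpt_dom]
  constructor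
  · rintro ⟨n, u, hu⟩
    obtain ⟨b, -, hb⟩ := Option.bind_eq_some_iff.1 hu
    by_contra h
    rw [if_neg fun hp => h ⟨b, hp⟩] at hb
    cases hb
  · rintro ⟨b, hb⟩
    exact ⟨Encodable.encode b, (), by simp [F, hb]⟩

theorem REPred.exists_code {α : Type*} [Primcodable α] {p : α → Prop} (hp : REPred p) :
    ∃ c : Nat.Partrec.Code, ∀ a, (c.eval (Encodable.encode a)).Dom ↔ p a := by
  obtain ⟨c, hc⟩ := Nat.Partrec.Code.exists_code.1 hp
  refine ⟨c, fun a => ?_⟩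
  rw [hc]
  simp [Part.assert]

/-! ### Equality in the graph monoid as rewriting of words -/

namespace LoopGraph

variable {V : Type u} (Γ : LoopGraph V)

/-- Names of rewriting rules: the direction, the kind of relation, and its parameters. -/
abbrev RuleName (V : Type u) : Type u := Bool × Bool × V × V × Bool × Bool

open Classical in
/-- The two sides of a rewriting rule. -/
noncomputable def rule (ρ : RuleName V) : List (V × Bool) × List (V × Bool) :=
  match ρ with
  | (d, k, v, w, s, t) =>
    let l := if k then ([(v, true), (v, false)], []) else
      if Γ.Adj v w then ([(v, s), (w, t)], [(w, t), (v, s)]) else ([], [])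
    if d then l else l.swap

theorem rule_not (d : Bool) (ρ : Bool × V × V × Bool × Bool) :
    Γ.rule (!d, ρ) = (Γ.rule (d, ρ)).swap := by
  cases d <;> simp [rule]

theorem wordClass_rule (ρ : RuleName V) :
    Γ.wordClass (Γ.rule ρ).1 = Γ.wordClass (Γ.rule ρ).2 := by
  have h (ρ : Bool × V × V × Bool × Bool) :
      Γ.wordClass (Γ.rule (true, ρ)).1 = Γ.wordClass (Γ.rule (true, ρ)).2 := by
    obtain ⟨k, v, w, s, t⟩ := ρ
    simp only [rule, if_true]
    split_ifs with h1 h2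
    · exact PresentedMonoid.mk_eq_mk_of_rel (.cancel v)
    · exact PresentedMonoid.mk_eq_mk_of_rel (.comm v w s t h2)
    · rfl
  obtain ⟨d, ρ⟩ := ρ
  cases d with
  | true => exact h ρ
  | false =>
    rw [show false = !true from rfl, rule_not]
    exact (h ρ).symm

/-- One application of a rewriting rule. -/
def Rewrites (g g' : List (V × Bool)) : Prop :=
  ∃ u ρ w, g = u ++ (Γ.rule ρ).1 ++ w ∧ g' = u ++ (Γ.rule ρ).2 ++ w

theorem Rewrites.symm {g g' : List (V × Bool)} (h : Γ.Rewrites g g') : Γ.Rewrites g' g := by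
  obtain ⟨u, ⟨d, ρ⟩, w, rfl, rfl⟩ := h
  exact ⟨u, (!d, ρ), w, by simp [rule_not], by simp [rule_not]⟩

theorem Rewrites.append {g g' : List (V × Bool)} (h : Γ.Rewrites g g') (a b : List (V × Bool)) :
    Γ.Rewrites (a ++ g ++ b) (a ++ g' ++ b) := by
  obtain ⟨u, ρ, w, rfl, rfl⟩ := h
  exact ⟨a ++ u, ρ, w ++ b, by simp, by simp⟩

theorem rewrites_of_rel {g g' : FreeMonoid (V × Bool)} (h : Γ.Rel g g') :
    Γ.Rewrites g.toList g'.toList := by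
  cases h with
  | cancel v => exact ⟨[], (true, true, v, v, true, true), [], by simp [rule], by simp [rule]⟩
  | comm v w s t h =>
    exact ⟨[], (true, false, v, w, s, t), [], by simp [rule, h], by simp [rule, h]⟩

theorem reflTransGen_rewrites_symm {g g' : List (V × Bool)}
    (h : ReflTransGen Γ.Rewrites g g') : ReflTransGen Γ.Rewrites g' g := by
  induction h with
  | refl => exact .refl
  | tail _ hs ih => exact .head hs.symm ih

theorem reflTransGen_rewrites_append {g g' : List (V × Bool)}
    (h : ReflTransGen Γ.Rewrites g g') (a b : List (V × Bool)) :
    ReflTransGen Γ.Rewrites (a ++ g ++ b) (a ++ g' ++ b) := by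
  induction h with
  | refl => exact .refl
  | tail _ hs ih => exact ih.tail (hs.append Γ a b)

/-- Rules exist in both directions and apply in any context, so rewriting is itself a congruence; a
product is rewritten one factor after the other. -/
theorem reflTransGen_rewrites_of_conGen {g g' : FreeMonoid (V × Bool)}
    (h : ConGen.Rel Γ.Rel g g') : ReflTransGen Γ.Rewrites g.toList g'.toList := by
  induction h with
  | of g g' h => exact .single (Γ.rewrites_of_rel h)
  | refl g => exact .refl
  | symm _ ih => exact Γ.reflTransGen_rewrites_symm ih
  | trans _ _ ih ih' => exact ih.trans ih'
  | @mul a b c d _ _ ih ih' =>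
    have h₁ := Γ.reflTransGen_rewrites_append ih [] c.toList
    have h₂ := Γ.reflTransGen_rewrites_append ih' b.toList []
    simp only [List.nil_append, List.append_nil] at h₁ h₂
    exact h₁.trans h₂

theorem reflTransGen_rewrites_of_wordClass_eq {g g' : List (V × Bool)}
    (h : Γ.wordClass g = Γ.wordClass g') : ReflTransGen Γ.Rewrites g g' :=
  Γ.reflTransGen_rewrites_of_conGen (PresentedMonoid.mk_eq_mk_iff.1 h)

end LoopGraph

/-! ### Runs of a described automaton as lists of choices -/

namespace ValenceCode

variable {V : Type u} (Γ : LoopGraph V)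

/-- Configurations that are represented by words: state, input read so far, storage word. -/
abbrev WordConf (V : Type u) : Type u := ℕ × List ℕ × List (V × Bool)

/-- The choices in a run: take an edge, or rewrite the storage word. -/
abbrev Choice (V : Type u) : Type u :=
  (ℕ × List ℕ × List (V × Bool) × ℕ) ⊕
    (List (V × Bool) × LoopGraph.RuleName V × List (V × Bool))

open Classical in
/-- The effect of taking an edge. -/
noncomputable def takeEdge (A : ValenceCode V) (c : WordConf V)
    (e : ℕ × List ℕ × List (V × Bool) × ℕ) : WordConf V :=
  if e ∈ A.edges ∧ e.1 = c.1 ∧ e.2.2.2 ≤ A.lastState then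
    (e.2.2.2, c.2.1 ++ e.2.1, c.2.2 ++ e.2.2.1) else c

open Classical in
/-- The effect of rewriting the storage word. -/
noncomputable def rewriteWord (c : WordConf V)
    (e : List (V × Bool) × LoopGraph.RuleName V × List (V × Bool)) : WordConf V :=
  if c.2.2 = e.1 ++ (Γ.rule e.2.1).1 ++ e.2.2 then
    (c.1, c.2.1, e.1 ++ (Γ.rule e.2.1).2 ++ e.2.2) else c

/-- The effect of a choice. -/
noncomputable def choose (A : ValenceCode V) (c : WordConf V) (e : Choice V) : WordConf V :=
  Sum.casesOn e (takeEdge A c) (rewriteWord Γ c)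

/-- The configuration that is reached by a list of choices. -/
noncomputable def run (A : ValenceCode V) (l : List (Choice V)) : WordConf V :=
  l.foldl (choose Γ A) (0, [], [])

/-- The list of choices shows that the described automaton accepts the word. -/
def Witnesses (p : ValenceCode V × List ℕ) (l : List (Choice V)) : Prop :=
  (run Γ p.1 l).1 ∈ p.1.final ∧ (run Γ p.1 l).2 = (p.2, [])

theorem run_concat (A : ValenceCode V) (l : List (Choice V)) (e : Choice V) :
    run Γ A (l ++ [e]) = choose Γ A (run Γ A l) e := by
  simp [run]

theorem exists_run_of_rewrites (A : ValenceCode V) {g g' : List (V × Bool)}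
    (h : ReflTransGen Γ.Rewrites g g') (l : List (Choice V)) {q : ℕ} {y : List ℕ}
    (hl : run Γ A l = (q, y, g)) : ∃ l', run Γ A l' = (q, y, g') := by
  induction h with
  | refl => exact ⟨l, hl⟩
  | tail _ hs ih =>
    obtain ⟨l', hl'⟩ := ih
    obtain ⟨u, ρ, w, rfl, rfl⟩ := hs
    exact ⟨l' ++ [.inr (u, ρ, w)], by simp [run_concat, hl', choose, rewriteWord]⟩

/-- Along the run the labels are merely concatenated; the single equation with `1` at the end is
then unfolded into rewriting steps. -/
theorem exists_witness_of_mem (k : ℕ) (A : ValenceCode V) (x : List (Fin k))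
    (h : x ∈ (A.toAutomaton Γ k).language) : ∃ l, Witnesses Γ (A, x.map Fin.val) l := by
  obtain ⟨f, hf, h⟩ := h
  have key : ∀ c, ReflTransGen (A.toAutomaton Γ k).Step ((A.toAutomaton Γ k).init, [], 1) c →
      ∃ l g, run Γ A l = ((show Fin _ from c.1).val, c.2.1.map Fin.val, g) ∧
        c.2.2 = Γ.wordClass g := by
    intro c hc
    induction hc with
    | refl => exact ⟨[], [], rfl, rfl⟩
    | @tail c c' _ hs ih =>
      obtain ⟨l, g, hl, hg⟩ := ih
      obtain ⟨y, n, ⟨g', hg', hn⟩, hy, hm⟩ := hs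
      refine ⟨l ++ [.inl ((show Fin _ from c.1).val, y.map Fin.val, g',
        (show Fin _ from c'.1).val)], g ++ g', ?_, ?_⟩
      · rw [run_concat, hl]
        change takeEdge A _ _ = _
        rw [takeEdge, if_pos ⟨hg', rfl, Nat.lt_succ_iff.1 (show Fin _ from c'.1).isLt⟩]
        simp [hy]
      · rw [hm, hg, LoopGraph.wordClass_append]
        exact congrArg _ hn
  obtain ⟨l, g, hl, hg⟩ := key _ h
  obtain ⟨l', hl'⟩ := exists_run_of_rewrites Γ A
    (Γ.reflTransGen_rewrites_of_wordClass_eq (g := g) (g' := []) hg.symm) l hl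
  exact ⟨l', by rw [hl']; exact hf, by rw [hl']⟩

/-- Inapplicable choices have no effect, so every list is a run. Edges with letters out of range may
be taken, but then the input is no image under `Fin.val`, and the claim along the run is restricted
to such images. -/
theorem mem_of_witnesses (k : ℕ) (A : ValenceCode V) (x : List (Fin k)) (l : List (Choice V))
    (h : Witnesses Γ (A, x.map Fin.val) l) : x ∈ (A.toAutomaton Γ k).language := by
  have key : ∀ l : List (Choice V), ∃ hlt : (run Γ A l).1 < A.lastState + 1,
      ∀ x : List (Fin k), (run Γ A l).2.1 = x.map Fin.val →
        ReflTransGen (A.toAutomaton Γ k).Step ((A.toAutomaton Γ k).init, [], 1)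
          ((⟨(run Γ A l).1, hlt⟩ : Fin _), x, Γ.wordClass (run Γ A l).2.2) := by
    intro l
    induction l using List.reverseRecOn with
    | nil =>
      refine ⟨Nat.succ_pos _, fun x hx => ?_⟩
      obtain rfl : x = [] := by simpa using (show [] = x.map Fin.val from hx).symm
      exact .refl
    | append_singleton l e ih =>
      rw [run_concat]
      generalize run Γ A l = c at *
      obtain ⟨hlt, ih⟩ := ih
      rcases e with e | e
      · change ∃ hlt : (takeEdge A c e).1 < A.lastState + 1, ∀ x : List (Fin k),
          (takeEdge A c e).2.1 = x.map Fin.val →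
            ReflTransGen (A.toAutomaton Γ k).Step ((A.toAutomaton Γ k).init, [], 1)
            ((⟨(takeEdge A c e).1, hlt⟩ : Fin _), x, Γ.wordClass (takeEdge A c e).2.2)
        by_cases he : e ∈ A.edges ∧ e.1 = c.1 ∧ e.2.2.2 ≤ A.lastState
        · simp only [takeEdge, if_pos he]
          refine ⟨Nat.lt_succ_of_le he.2.2, fun x hx => ?_⟩
          obtain ⟨x₁, x₂, rfl, h1, h2⟩ := List.append_eq_map_iff.1 hx
          refine (ih x₁ h1.symm).tail ⟨x₂, Γ.wordClass e.2.2.1, ⟨e.2.2.1, ?_, rfl⟩, rfl,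
            Γ.wordClass_append _ _⟩
          simp only [h2, ← he.2.1]
          exact he.1
        · simp only [takeEdge, if_neg he]
          exact ⟨hlt, ih⟩
      · change ∃ hlt : (rewriteWord Γ c e).1 < A.lastState + 1, ∀ x : List (Fin k),
          (rewriteWord Γ c e).2.1 = x.map Fin.val →
            ReflTransGen (A.toAutomaton Γ k).Step ((A.toAutomaton Γ k).init, [], 1)
            ((⟨(rewriteWord Γ c e).1, hlt⟩ : Fin _), x, Γ.wordClass (rewriteWord Γ c e).2.2)
        by_cases he : c.2.2 = e.1 ++ (Γ.rule e.2.1).1 ++ e.2.2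
        · simp only [rewriteWord, if_pos he]
          refine ⟨hlt, fun x hx => ?_⟩
          have := ih x hx
          rw [he] at this
          simpa only [LoopGraph.wordClass_append, Γ.wordClass_rule] using this
        · simp only [rewriteWord, if_neg he]
          exact ⟨hlt, ih⟩
  obtain ⟨hlt, hr⟩ := key l
  refine ⟨(⟨(run Γ A l).1, hlt⟩ : Fin _), h.1, ?_⟩
  have := hr x (by rw [h.2])
  rw [h.2] at this
  exact this

/-! ### Checking a list of choices is primitive recursive -/

section

variable [Primcodable V]

theorem primrec_edges : Primrec (ValenceCode.edges : ValenceCode V → _) :=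
  (Primrec.fst.comp Primrec.snd).comp (Primrec.of_equiv (e := equivProd V))

theorem primrec_lastState : Primrec (ValenceCode.lastState : ValenceCode V → _) :=
  Primrec.fst.comp (Primrec.of_equiv (e := equivProd V))

theorem primrec_final : Primrec (ValenceCode.final : ValenceCode V → _) :=
  (Primrec.snd.comp Primrec.snd).comp (Primrec.of_equiv (e := equivProd V))

theorem _root_.PrimrecRel.mem_list {α : Type*} [Primcodable α] :
    PrimrecRel fun (a : α) (l : List α) => a ∈ l :=
  (PrimrecRel.exists_mem_list Primrec.eq).swap.of_eq fun a l => by simp [Function.swap]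

variable [Finite V]

theorem primrec_choose :
    Primrec fun p : ValenceCode V × WordConf V × Choice V => choose Γ p.1 p.2.1 p.2.2 := by
  classical
  refine Primrec.sumCasesOn (Primrec.snd.comp Primrec.snd) (Primrec₂.mk ?_) (Primrec₂.mk ?_)
  · have A : Primrec fun p : (ValenceCode V × WordConf V × Choice V) ×
        (ℕ × List ℕ × List (V × Bool) × ℕ) => p.1.1 := Primrec.fst.comp Primrec.fst
    have c : Primrec fun p : (ValenceCode V × WordConf V × Choice V) ×
        (ℕ × List ℕ × List (V × Bool) × ℕ) => p.1.2.1 :=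
      Primrec.fst.comp (Primrec.snd.comp Primrec.fst)
    have e : Primrec fun p : (ValenceCode V × WordConf V × Choice V) ×
        (ℕ × List ℕ × List (V × Bool) × ℕ) => p.2 := Primrec.snd
    have e2 := Primrec.snd.comp e
    have e3 := Primrec.snd.comp e2
    refine Primrec.ite ((PrimrecRel.mem_list.comp e (primrec_edges.comp A)).and
      ((Primrec.eq.comp (Primrec.fst.comp e) (Primrec.fst.comp c)).and
        (Primrec.nat_le.comp (Primrec.snd.comp e3) (primrec_lastState.comp A))))
      (Primrec.pair (Primrec.snd.comp e3) (Primrec.pair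
        (Primrec.list_append.comp (Primrec.fst.comp (Primrec.snd.comp c)) (Primrec.fst.comp e2))
        (Primrec.list_append.comp (Primrec.snd.comp (Primrec.snd.comp c))
          (Primrec.fst.comp e3)))) c
  · have c : Primrec fun p : (ValenceCode V × WordConf V × Choice V) ×
        (List (V × Bool) × LoopGraph.RuleName V × List (V × Bool)) => p.1.2.1 :=
      Primrec.fst.comp (Primrec.snd.comp Primrec.fst)
    have e : Primrec fun p : (ValenceCode V × WordConf V × Choice V) ×
        (List (V × Bool) × LoopGraph.RuleName V × List (V × Bool)) => p.2 := Primrec.snd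
    have u := Primrec.fst.comp e
    have w := Primrec.snd.comp (Primrec.snd.comp e)
    -- The only use of `Finite V`: a function on a finite type is primitive recursive, even one
    -- defined by classical choice from `Γ.Adj`.
    have ρ := (Primrec.dom_finite Γ.rule).comp (Primrec.fst.comp (Primrec.snd.comp e))
    exact Primrec.ite (Primrec.eq.comp (Primrec.snd.comp (Primrec.snd.comp c))
      (Primrec.list_append.comp (Primrec.list_append.comp u (Primrec.fst.comp ρ)) w))
      (Primrec.pair (Primrec.fst.comp c) (Primrec.pair (Primrec.fst.comp (Primrec.snd.comp c))
        (Primrec.list_append.comp (Primrec.list_append.comp u (Primrec.snd.comp ρ)) w))) c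

theorem primrec_run : Primrec₂ (run Γ : ValenceCode V → List (Choice V) → WordConf V) :=
  Primrec.list_foldl Primrec.snd (Primrec.const _)
    ((primrec_choose Γ).comp (Primrec.pair (Primrec.fst.comp Primrec.fst) Primrec.snd)).to₂

theorem primrecRel_witnesses : PrimrecRel (Witnesses Γ) := by
  have hrun : Primrec fun p : (ValenceCode V × List ℕ) × List (Choice V) => run Γ p.1.1 p.2 :=
    (primrec_run Γ).comp (Primrec.fst.comp Primrec.fst) Primrec.snd
  exact (PrimrecRel.mem_list.comp (Primrec.fst.comp hrun)
    (primrec_final.comp (Primrec.fst.comp Primrec.fst))).and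
    (Primrec.eq.comp (Primrec.snd.comp hrun) (Primrec.pair (Primrec.snd.comp Primrec.fst)
      (Primrec.const [])))

/-- One program semi-decides acceptance for all descriptions, and currying fixes the description.
Since letters are numbers, the same program serves every `k`. -/
theorem exists_automaton_to_code : ∃ f : ℕ → ValenceCode V → Nat.Partrec.Code, Computable₂ f ∧
    ∀ k A, reLanguage k (f k A) = (A.toAutomaton Γ k).language := by
  obtain ⟨c, hc⟩ := (REPred.exists_of_primrecRel (primrecRel_witnesses Γ)).exists_code
  refine ⟨fun _ A => c.curry (Encodable.encode A), Primrec.to_comp ?_, fun k A => ?_⟩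
  · exact Nat.Partrec.Code.primrec₂_curry.comp (Primrec.const c)
      (Primrec.encode.comp Primrec.snd)
  · ext x
    have : x ∈ reLanguage k (c.curry (Encodable.encode A)) ↔
        ∃ l, Witnesses Γ (A, x.map Fin.val) l := by
      change (Nat.Partrec.Code.eval _ _).Dom ↔ _
      rw [Nat.Partrec.Code.eval_curry, ← Encodable.encode_prod_val, hc]
    rw [this]
    exact ⟨fun ⟨l, hl⟩ => mem_of_witnesses Γ k A x l hl, exists_witness_of_mem Γ k A x⟩

end

end ValenceCode

/-! ### Change of alphabet and passage to descriptions -/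

namespace ValenceAutomaton

variable {X : Type v} {Y : Type*} {M : Type w} [Monoid M]

/-- The automaton that reads a word over `X` as the given automaton reads its image. -/
def comapLetters (B : ValenceAutomaton Y M) (e : X → Y) (he : Function.Injective e) :
    ValenceAutomaton X M where
  State := B.State
  finite_state := B.finite_state
  edges := {a | (a.1, a.2.1.map e, a.2.2.1, a.2.2.2) ∈ B.edges}
  finite_edges := by
    refine B.finite_edges.preimage (f := fun a : B.State × List X × M × B.State =>
      (a.1, a.2.1.map e, a.2.2.1, a.2.2.2)) (Function.Injective.injOn ?_)
    rintro ⟨p, x, m, q⟩ ⟨p', x', m', q'⟩ h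
    simp only [Prod.mk.injEq] at h
    obtain ⟨rfl, h2, rfl, rfl⟩ := h
    rw [List.map_injective_iff.2 he h2]
  init := B.init
  final := B.final

theorem mem_language_comapLetters (B : ValenceAutomaton Y M) (e : X → Y)
    (he : Function.Injective e) (x : List X) :
    x ∈ (B.comapLetters e he).language ↔ x.map e ∈ B.language := by
  constructor
  · rintro ⟨f, hf, h⟩
    refine ⟨f, hf, ?_⟩
    exact h.lift (p := B.Step) (fun c => (c.1, c.2.1.map e, c.2.2))
      (fun c c' ⟨y, n, h1, h2, h3⟩ => ⟨y.map e, n, h1, by simp [h2], h3⟩)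
  · rintro ⟨f, hf, h⟩
    refine ⟨f, hf, ?_⟩
    have key : ∀ c, ReflTransGen B.Step (B.init, [], 1) c → ∀ x : List X, c.2.1 = x.map e →
        ReflTransGen (B.comapLetters e he).Step (B.init, [], 1) (c.1, x, c.2.2) := by
      intro c hc
      induction hc with
      | refl =>
        intro x hx
        obtain rfl : x = [] := by simpa using hx.symm
        exact .refl
      | @tail c c' _ hs ih =>
        intro x hx
        obtain ⟨y, n, h1, h2, h3⟩ := hs
        obtain ⟨x₁, x₂, rfl, e1, rfl⟩ := List.append_eq_map_iff.1 (h2.symm.trans hx)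
        exact (ih x₁ e1.symm).tail ⟨x₂, n, h1, rfl, h3⟩
    exact key _ h x rfl

end ValenceAutomaton

theorem LoopGraph.exists_valenceCode {V : Type u} (Γ : LoopGraph V) {X : Type v} {k : ℕ}
    (e : X → Fin k) (he : Function.Injective e) (A : ValenceAutomaton X Γ.GraphMonoid) :
    ∃ c : ValenceCode V, ∀ x : List X,
      x ∈ A.language ↔ x.map e ∈ (c.toAutomaton Γ k).language := by
  classical
  have := A.finite_state
  obtain ⟨n, ⟨ε⟩⟩ := Finite.exists_equiv_fin A.State
  -- Descriptions start in state `0`, so the other states are shifted by one.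
  let ι : A.State → ℕ := fun q => if q = A.init then 0 else (ε q).val + 1
  have hι : Function.Injective ι := by
    intro q q' h
    simp only [ι] at h
    split_ifs at h with h1 h2 h2
    · rw [h1, h2]
    · exact ε.injective (Fin.ext (by omega))
  have hlt (q : A.State) : ι q < n + 1 := by
    simp only [ι]
    split_ifs
    · omega
    · exact Nat.succ_lt_succ (ε q).isLt
  have hrep (m : Γ.GraphMonoid) : ∃ g, Γ.wordClass g = m := by
    obtain ⟨g, rfl⟩ := PresentedMonoid.surjective_mk m
    exact ⟨g.toList, rfl⟩
  choose rep hrep using hrep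
  let c : ValenceCode V :=
    { lastState := n
      edges := A.finite_edges.toFinset.toList.map fun a =>
        (ι a.1, (a.2.1.map e).map Fin.val, rep a.2.2.1, ι a.2.2.2)
      final := (Set.toFinite A.final).toFinset.toList.map ι }
  let φ : A.State × List X × Γ.GraphMonoid → Fin (n + 1) × List (Fin k) × Γ.GraphMonoid :=
    fun a => (⟨ι a.1, hlt a.1⟩, a.2.1.map e, a.2.2)
  have hfinal (q : A.State) : ι q ∈ c.final ↔ q ∈ A.final := by
    simp [c, hι.eq_iff]
  have hinit : φ (A.init, [], 1) = ((c.toAutomaton Γ k).init, [], 1) := by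
    simp [φ, ι, ValenceCode.toAutomaton]
  refine ⟨c, fun x => ⟨?_, ?_⟩⟩
  · rintro ⟨f, hf, h⟩
    refine ⟨(φ (f, x, 1)).1, (hfinal f).2 hf, ?_⟩
    rw [← hinit]
    refine h.lift (p := (c.toAutomaton Γ k).Step) φ
      (fun a b ⟨y, m, h1, h2, h3⟩ => ⟨y.map e, m, ⟨rep m, ?_, (hrep m).symm⟩, ?_, h3⟩)
    · simp only [c, List.mem_map, Finset.mem_toList, Set.Finite.mem_toFinset]
      exact ⟨_, h1, rfl⟩
    · simp [φ, h2]
  · rintro ⟨f, hf, h⟩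
    rw [← hinit] at h
    have key : ∀ b, ReflTransGen (c.toAutomaton Γ k).Step (φ (A.init, [], 1)) b →
        ∃ a, φ a = b ∧ ReflTransGen A.Step (A.init, [], 1) a := by
      intro b hb
      induction hb with
      | refl => exact ⟨_, rfl, .refl⟩
      | @tail b b' _ hs ih =>
        obtain ⟨a, rfl, hr⟩ := ih
        obtain ⟨y, m, ⟨g, hg, hm⟩, h2, h3⟩ := hs
        simp only [c, List.mem_map, Finset.mem_toList, Set.Finite.mem_toFinset,
          Prod.mk.injEq] at hg
        obtain ⟨⟨p, z, m', q⟩, hmem, e1, e2, e3, e4⟩ := hg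
        simp only at e1 e2 e3 e4 hm
        have ep : p = a.1 := hι e1
        have ey : z.map e = y := List.map_injective_iff.2 Fin.val_injective e2
        have em : m = m' := by rw [hm, ← e3, hrep]
        refine ⟨(q, a.2.1 ++ z, a.2.2 * m'), ?_, hr.tail ⟨z, m', ?_, rfl, rfl⟩⟩
        · refine Prod.ext (Fin.ext e4) (Prod.ext ?_ ?_)
          · rw [h2, ← ey]; simp [φ]
          · rw [h3, em]
        · rw [← ep]; exact hmem
    obtain ⟨⟨q, y, m⟩, ha, hr⟩ := key _ h
    obtain ⟨rfl, ha'⟩ := Prod.mk.inj ha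
    obtain ⟨h2, rfl⟩ := Prod.mk.inj ha'
    obtain rfl : y = x := List.map_injective_iff.2 he h2
    exact ⟨q, (hfinal q).1 hf, hr⟩

/-! ### The main theorem -/

/-- Replacing letters by their codes does not change the code of a word, so programs for words over
`X` can be used over `Fin k` without translation. -/
theorem Encodable.encode_list_map_encode {X : Type v} [Encodable X] (x : List X) :
    Encodable.encode (x.map Encodable.encode) = Encodable.encode x := by
  induction x with
  | nil => rfl
  | cons a x ih => simp [Encodable.encode_list_cons, ih]

theorem exists_injective_val_eq_encode (X : Type v) [Finite X] [Encodable X] :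
    ∃ (k : ℕ) (e : X → Fin k), Function.Injective e ∧ ∀ a, (e a).val = Encodable.encode a := by
  obtain ⟨k, hk⟩ := (Set.finite_range (Encodable.encode : X → ℕ)).bddAbove
  refine ⟨k + 1, fun a => ⟨Encodable.encode a, Nat.lt_succ_of_le (hk ⟨a, rfl⟩)⟩, ?_, fun _ => rfl⟩
  intro a b h
  exact Encodable.encode_injective (congrArg Fin.val h)

theorem VA_eq_setOf_rePred {V : Type u} [Finite V] [Primcodable V] (Γ : LoopGraph V)
    (hg : ∃ g : ℕ → Nat.Partrec.Code → ValenceCode V, Computable₂ g ∧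
      ∀ k c, ((g k c).toAutomaton Γ k).language = reLanguage k c)
    (X : Type v) [Finite X] [Primcodable X] :
    VA Γ.GraphMonoid X = {L : Language X | REPred fun x : List X => x ∈ L} := by
  obtain ⟨k, e, he, hval⟩ := exists_injective_val_eq_encode X
  have hcode (x : List X) :
      Encodable.encode ((x.map e).map Fin.val) = Encodable.encode x := by
    rw [← Encodable.encode_list_map_encode x, List.map_map]
    congr 2
    funext a
    exact hval a
  ext L
  constructor
  · rintro ⟨A, rfl⟩
    obtain ⟨c, hc⟩ := Γ.exists_valenceCode e he A
    obtain ⟨f, -, hf⟩ := ValenceCode.exists_automaton_to_code Γ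
    refine (Partrec.dom_re (Nat.Partrec.Code.eval_part.comp (Computable.const (f k c))
      Computable.encode)).of_eq fun x => ?_
    rw [hc, ← hf, ← hcode]
    rfl
  · intro hL
    obtain ⟨c, hc⟩ := REPred.exists_code hL
    obtain ⟨g, -, hg⟩ := hg
    refine ⟨((g k c).toAutomaton Γ k).comapLetters e he, ?_⟩
    ext x
    rw [ValenceAutomaton.mem_language_comapLetters, hg, ← hc, ← hcode]
    rfl

/-- Precomposing `c` with the constant `0` gives a program that halts on all inputs or on none,
according to whether `c` halts on `0`. The empty word witnesses non-emptiness, so even `k = 0` is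
covered. -/
theorem not_computablePred_empty {V : Type u} [Primcodable V] (Γ : LoopGraph V)
    (hg : ∃ g : ℕ → Nat.Partrec.Code → ValenceCode V, Computable₂ g ∧
      ∀ k c, ((g k c).toAutomaton Γ k).language = reLanguage k c) (k : ℕ) :
    ¬ ComputablePred fun A : ValenceCode V =>
      (A.toAutomaton Γ k).language = (∅ : Set (List (Fin k))) := by
  obtain ⟨g, hgc, hg⟩ := hg
  intro h
  refine ComputablePred.halting_problem 0 ?_
  have hF : Computable fun c : Nat.Partrec.Code => g k (c.comp .zero) :=
    hgc.comp (Computable.const k) (Nat.Partrec.Code.primrec₂_comp.to_comp.comp Computable.id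
      (Computable.const _))
  refine (ComputablePred.computable_of_manyOneReducible (p := fun c => _)
    ⟨_, hF, fun _ => Iff.rfl⟩ h).not.of_eq fun c => ?_
  have heval (n : ℕ) : (Nat.Partrec.Code.comp c .zero).eval n = c.eval 0 := by
    exact Part.bind_some 0 c.eval
  rw [hg]
  refine Iff.trans Set.nonempty_iff_ne_empty.symm ?_
  constructor
  · rintro ⟨x, hx⟩
    exact heval _ ▸ hx
  · intro hc
    refine ⟨[], ?_⟩
    change (Nat.Partrec.Code.eval _ _).Dom
    rw [heval]
    exact hc

theorem mainTheorem2 {V : Type u} [Finite V] [Primcodable V] (Γ : LoopGraph V)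
    (hΓ : (SimpleGraph.cycleGraph 4).IsIndContained Γ.deleteLoops ∨
      (SimpleGraph.pathGraph 4).IsIndContained Γ.deleteLoops) :
    -- over every finite alphabet, `VA(𝕄Γ)` is the class of recursively enumerable languages
    (∀ (X : Type v) [Finite X] [Primcodable X],
      VA Γ.GraphMonoid X = {L : Language X | REPred fun x : List X => x ∈ L}) ∧
    -- both inclusions are effective, uniformly in the size `k` of the alphabet
    (∃ f : ℕ → ValenceCode V → Nat.Partrec.Code, Computable₂ f ∧
      ∀ k A, reLanguage k (f k A) = (A.toAutomaton Γ k).language) ∧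
    (∃ g : ℕ → Nat.Partrec.Code → ValenceCode V, Computable₂ g ∧
      ∀ k c, ((g k c).toAutomaton Γ k).language = reLanguage k c) ∧
    -- emptiness is undecidable, also for every fixed alphabet
    (¬ ComputablePred fun p : ℕ × ValenceCode V =>
      (p.2.toAutomaton Γ p.1).language = (∅ : Set (List (Fin p.1)))) ∧
    (∀ k : ℕ, ¬ ComputablePred fun A : ValenceCode V =>
      (A.toAutomaton Γ k).language = (∅ : Set (List (Fin k)))) := by
  obtain ⟨p, q, r, s, hQ⟩ := Γ.exists_isQuad hΓ
  have hg := hQ.exists_code_to_automaton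
  refine ⟨fun X _ _ => VA_eq_setOf_rePred Γ hg X, ValenceCode.exists_automaton_to_code Γ, hg,
    fun h => not_computablePred_empty Γ hg 0 ?_, not_computablePred_empty Γ hg⟩
  exact ComputablePred.computable_of_manyOneReducible
    ⟨fun A => (0, A), (Computable.const 0).pair Computable.id, fun _ => Iff.rfl⟩ h
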